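/- Let $g,n,r\ge 0$ be integers, and let $\Gamma=\langle \alpha_1,\beta_1,\dots,\alpha_g,\beta_g,\gamma_1,\dots,\gamma_n \mid [\alpha_1,\beta_1]\cdots[\alpha_g,\beta_g]\gamma_1\cdots\gamma_n=1\rangle$ be the fundamental group of a surface of genus $g$ with $n$ punctures. Let $\mathbf d=\{(d^{(i)}_0,\dots,d^{(i)}_{s_i})\}_{1\le i\le n}$ be tuples of positive integers with $\sum_{\ell} d^{(i)}_\ell=r$ for every $i$. All varieties are classical (reduced, not necessarily irreducible) complex varieties. Let $\mathfrak{PRP}(r,\mathbf d)$ be the variety of pairs $(\rho,\mathbf P)$, where $\rho:\Gamma\to \mathrm{GL}(r,\mathbb C)$ is a representation and $\mathbf P=(P_{\mathcal F^{(i)}})_i$ is given by flags $\mathcal F^{(i)}:\ \mathbb C^r=V^{(i)}_0\supsetneq V^{(i)}_1\supsetneq\cdots\supsetneq V^{(i)}_{s_i}\supsetneq V^{(i)}_{s_i+1}=0$ with $\dim V^{(i)}_\ell/V^{(i)}_{\ell+1}=d^{(i)}_\ell$, such that $\rho(\gamma_i)$ preserves $\mathcal F^{(i)}$ for all $i$.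 It is regarded as a subvariety of $\mathrm{Hom}(\Gamma,\mathrm{GL}(r,\mathbb C))\times\prod_i\mathrm{FL}(r,\mathbf d^{(i)})$, with coordinates the matrix entries of the $\rho(\alpha_j),\rho(\beta_j),\rho(\gamma_i)$ and the Plücker coordinates of the $V^{(i)}_\ell$, $1\le \ell\le s_i$. The group $\mathrm{GL}(r,\mathbb C)$ acts on it by conjugating $\rho$ and moving the flags. Let $Q$ be the quiver with vertices $u$ and $u^{(i)}_\ell$ ($1\le i\le n$, $1\le \ell\le s_i$), with loops $a_j,b_j$ ($1\le j\le g$) and $c^{(i)}$ at $u$, with arrows $e^{(i)}_\ell:u^{(i)}_\ell\to u^{(i)}_{\ell-1}$ (where $u^{(i)}_0=u$), and with loops $c^{(i)}_\ell$ at $u^{(i)}_\ell$. Its dimension vector $\overrightarrow{d_Q}$ is $d_u=r$, $d_{u^{(i)}_\ell}=\sum_{j\ge \ell}d^{(i)}_j$, and $\mathrm{GL}(\overrightarrow{d_Q})=\prod_v\mathrm{GL}(d_v,\mathbb C)$ acts on the affine space of representations by $(h\cdot x)_a=h_{t(a)}x_ah_{s(a)}^{-1}$. Let $\mathfrak{REP}_{\mathrm{prp}}(Q,\overrightarrow{d_Q})$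 be the set of representations $x$ such that every $x_a$ is injective, $x_{c^{(i)}_{\ell-1}}x_{e^{(i)}_\ell}=x_{e^{(i)}_\ell}x_{c^{(i)}_\ell}$ for all $1\le i\le n$, $1\le\ell\le s_i$ (where $c^{(i)}_0=c^{(i)}$), and $[x_{a_1},x_{b_1}]\cdots[x_{a_g},x_{b_g}]x_{c^{(1)}}\cdots x_{c^{(n)}}=\mathrm{Id}$; it is invariant under $\mathrm{GL}(\overrightarrow{d_Q})$. Then $\mathfrak{REP}_{\mathrm{prp}}(Q,\overrightarrow{d_Q})$ and $\mathfrak{PRP}(r,\mathbf d)$ are, in these coordinates, locally closed subsets of an affine space and of a product of an affine space with projective spaces, respectively, and there is a morphism of varieties $$\varphi:\mathfrak{REP}_{\mathrm{prp}}(Q,\overrightarrow{d_Q})\longrightarrow\mathfrak{PRP}(r,\mathbf d),\qquad x\longmapsto(\rho,\mathbf P),$$ with $\rho(\alpha_j)=x_{a_j}$, $\rho(\beta_j)=x_{b_j}$, $\rho(\gamma_i)=x_{c^{(i)}}$ and $V^{(i)}_\ell=\mathrm{im}(x_{e^{(i)}_1}\circ\cdots\circ x_{e^{(i)}_\ell})$,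 which is equivariant: $\varphi(h\cdot x)=h_u\cdot\varphi(x)$ for all $h\in\mathrm{GL}(\overrightarrow{d_Q})$. Moreover $\varphi$ is a geometric quotient for the action of $G'=\prod_{v\ne u}\mathrm{GL}(d_v,\mathbb C)$: it is a $G'$-invariant surjective morphism, its fibres are exactly the $G'$-orbits, a subset $U$ of the target is open if and only if $\varphi^{-1}(U)$ is open, and for every open $U$ each $G'$-invariant regular function on $\varphi^{-1}(U)$ is the pullback of a regular function on $U$. -/

import Mathlib

open scoped LinearAlgebra.Projectivization Topology

/-! ## Classical complex varieties inside products of an affine space and projective spaces -/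

/-- Points of the ambient variety `𝔸^ι × ∏ k, ℙ(ℂ^(J k))`. -/
structure Ambient (ι K : Type) (J : K → Type) where
  aff : ι → ℂ
  proj : ∀ k, ℙ ℂ (J k → ℂ)

namespace Ambient

variable {ι K : Type} {J : K → Type}

/-- The multidegree of the coordinates: the affine coordinates have degree `0`, the homogeneous
coordinates of the `k`-th projective factor have degree one in the `k`-th direction. -/
noncomputable def multidegree : ι ⊕ (Σ k, J k) → (K →₀ ℕ) :=
  Sum.elim (fun _ => 0) (fun kj => Finsupp.single kj.1 1)

/-- Polynomials in the coordinates that are homogeneous of multidegree `m`. -/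
def IsMultihomogeneous (F : MvPolynomial (ι ⊕ (Σ k, J k)) ℂ) (m : K →₀ ℕ) : Prop :=
  MvPolynomial.IsWeightedHomogeneous multidegree F m

/-- The value of a polynomial at a point, computed in chosen homogeneous coordinates. Below it is
only used for non-vanishing of multihomogeneous polynomials and for quotients of two such
polynomials of the same multidegree; these do not depend on the choice. -/
noncomputable def evalAt (F : MvPolynomial (ι ⊕ (Σ k, J k)) ℂ) (p : Ambient ι K J) : ℂ :=
  MvPolynomial.eval (Sum.elim p.aff (fun kj => (p.proj kj.1).rep kj.2)) F

/-- The Zariski topology: non-vanishing loci of multihomogeneous polynomials are a basis. -/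
instance zariski : TopologicalSpace (Ambient ι K J) :=
  TopologicalSpace.generateFrom
    {U | ∃ F m, IsMultihomogeneous F m ∧ U = {p : Ambient ι K J | evalAt F p ≠ 0}}

end Ambient

/-- A coordinate system on a set `X`: a map to an ambient variety, through which `X` acquires a
Zariski topology and regular functions. -/
structure Coordinates (X : Type) where
  ι : Type
  K : Type
  J : K → Type
  toAmbient : X → Ambient ι K J

namespace Coordinates

variable {X Y : Type}

/-- The coordinates identify `X` with a quasi-projective variety, that is, with a locally closed
subset of a finite-dimensional `𝔸^ι × ∏ k, ℙ(ℂ^(J k))`. -/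
def IsVariety (c : Coordinates X) : Prop :=
  Finite c.ι ∧ Finite c.K ∧ (∀ k, Finite (c.J k)) ∧
    Function.Injective c.toAmbient ∧ IsLocallyClosed (Set.range c.toAmbient)

/-- The Zariski topology on `X`. -/
@[reducible]
def topology (c : Coordinates X) : TopologicalSpace X :=
  TopologicalSpace.induced c.toAmbient Ambient.zariski

/-- The restriction of `f` to `U` is a regular function on `U` (used for open sets `U`): near every
point of `U` it is a quotient of two multihomogeneous polynomials of the same multidegree.
The values of `f` outside `U` are irrelevant. -/
def IsRegularOn (c : Coordinates X) (U : Set X) (f : X → ℂ) : Prop :=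
  ∀ p ∈ U, ∃ W : Set X, IsOpen[c.topology] W ∧ p ∈ W ∧
    ∃ F G m, Ambient.IsMultihomogeneous F m ∧ Ambient.IsMultihomogeneous G m ∧
      ∀ q ∈ W ∩ U, Ambient.evalAt G (c.toAmbient q) ≠ 0 ∧
        f q = Ambient.evalAt F (c.toAmbient q) / Ambient.evalAt G (c.toAmbient q)

/-- Morphisms of varieties: continuous maps that pull back regular functions on open sets to
regular functions. -/
def IsMorphism (cX : Coordinates X) (cY : Coordinates Y) (f : X → Y) : Prop :=
  Continuous[cX.topology, cY.topology] f ∧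
    ∀ (V : Set Y) (h : Y → ℂ), IsOpen[cY.topology] V → cY.IsRegularOn V h →
      cX.IsRegularOn (f ⁻¹' V) (h ∘ f)

/-- `f : X → Y` is a geometric quotient of the variety `X` by the action of the group `H`. -/
structure IsGeometricQuotient (cX : Coordinates X) (cY : Coordinates Y)
    (H : Type) [Group H] [MulAction H X] (f : X → Y) : Prop where
  isMorphism : IsMorphism cX cY f
  invariant : ∀ (h : H) (x : X), f (h • x) = f x
  surjective : Function.Surjective f
  fibre_orbit : ∀ x x' : X, f x = f x' → ∃ h : H, h • x = x'
  submersive : ∀ U : Set Y, IsOpen[cY.topology] U ↔ IsOpen[cX.topology] (f ⁻¹' U)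
  functions : ∀ U : Set Y, IsOpen[cY.topology] U → ∀ k : X → ℂ,
    cX.IsRegularOn (f ⁻¹' U) k → (∀ (h : H), ∀ x ∈ f ⁻¹' U, k (h • x) = k x) →
      ∃ k' : Y → ℂ, cY.IsRegularOn U k' ∧ ∀ x ∈ f ⁻¹' U, k' (f x) = k x

end Coordinates

/-! ## Types and flags -/

/-- For a tuple `(d_0, …, d_s)`, the sum of the `d_j` with `j ≥ ℓ`. -/
def tailSum {s : ℕ} (d : Fin (s + 1) → ℕ) (ℓ : Fin (s + 1)) : ℕ :=
  ∑ j ∈ Finset.Ici ℓ, d j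

/-- A type `𝐝 = (d^(i)_0, …, d^(i)_{s_i})_i`, with one composition of `r` for each of the `n`
punctures. -/
structure ParabolicType (n r : ℕ) where
  s : Fin n → ℕ
  d : ∀ i, Fin (s i + 1) → ℕ
  pos : ∀ i ℓ, 0 < d i ℓ
  sum_eq : ∀ i, ∑ ℓ, d i ℓ = r

/-- Flags `ℂ^r = V_0 ⊇ V_1 ⊇ ⋯ ⊇ V_s ⊇ V_{s+1} = 0` of type `(d_0, …, d_s)`, where
`d_ℓ = dim V_ℓ / V_{ℓ+1}`; equivalently `dim V_ℓ` is the sum of the `d_j` with `j ≥ ℓ`. -/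
@[ext]
structure TypedFlag (r : ℕ) {s : ℕ} (d : Fin (s + 1) → ℕ) where
  sub : Fin (s + 1) → Submodule ℂ (Fin r → ℂ)
  sub_zero : sub 0 = ⊤
  antitone : Antitone sub
  finrank_sub : ∀ ℓ, Module.finrank ℂ (sub ℓ) = tailSum d ℓ

theorem mulVecLin_GL_injective {r : ℕ} (A : GL (Fin r) ℂ) :
    Function.Injective (Matrix.mulVecLin (A : Matrix (Fin r) (Fin r) ℂ)) := by
  intro v w h
  have h2 := congrArg (fun z => Matrix.mulVec ((A⁻¹ : GL (Fin r) ℂ) : Matrix (Fin r) (Fin r) ℂ) z) h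
  simpa [Matrix.mulVecLin_apply, Matrix.mulVec_mulVec, ← Units.val_mul] using h2

/-- `GL_r` acts on flags by moving each subspace. -/
noncomputable instance TypedFlag.instMulAction (r : ℕ) {s : ℕ} (d : Fin (s + 1) → ℕ) :
    MulAction (GL (Fin r) ℂ) (TypedFlag r d) where
  smul A 𝓕 :=
    { sub := fun ℓ => (𝓕.sub ℓ).map (Matrix.mulVecLin (A : Matrix (Fin r) (Fin r) ℂ))
      sub_zero := by
        rw [𝓕.sub_zero, Submodule.map_top, LinearMap.range_eq_top]
        exact LinearMap.surjective_of_injective (mulVecLin_GL_injective A)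
      antitone := fun _ _ h => Submodule.map_mono (𝓕.antitone h)
      finrank_sub := fun ℓ => by
        rw [← 𝓕.finrank_sub ℓ]
        exact (Submodule.equivMapOfInjective _ (mulVecLin_GL_injective A) _).finrank_eq.symm }
  one_smul 𝓕 := by
    apply TypedFlag.ext
    funext ℓ
    change (𝓕.sub ℓ).map (Matrix.mulVecLin ((1 : GL (Fin r) ℂ) : Matrix (Fin r) (Fin r) ℂ)) = _
    rw [Units.val_one, Matrix.mulVecLin_one, Submodule.map_id]
  mul_smul A B 𝓕 := by
    apply TypedFlag.ext
    funext ℓ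
    change (𝓕.sub ℓ).map (Matrix.mulVecLin ((A * B : GL (Fin r) ℂ) : Matrix (Fin r) (Fin r) ℂ)) =
      ((𝓕.sub ℓ).map (Matrix.mulVecLin (B : Matrix (Fin r) (Fin r) ℂ))).map
        (Matrix.mulVecLin (A : Matrix (Fin r) (Fin r) ℂ))
    rw [Units.val_mul, Matrix.mulVecLin_mul, Submodule.map_comp]

/-- The parabolic subgroup of all automorphisms preserving a flag. -/
noncomputable def TypedFlag.parabolic {r s : ℕ} {d : Fin (s + 1) → ℕ} (𝓕 : TypedFlag r d) :
    Subgroup (GL (Fin r) ℂ) :=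
  MulAction.stabilizer (GL (Fin r) ℂ) 𝓕

/-! ## Plücker coordinates -/

/-- The matrix whose columns are a (chosen) basis of the `k`-dimensional subspace `W`. -/
noncomputable def basisMatrix {r k : ℕ} (W : Submodule ℂ (Fin r → ℂ))
    (hW : Module.finrank ℂ W = k) : Matrix (Fin r) (Fin k) ℂ :=
  Matrix.of fun i j => (Module.finBasisOfFinrankEq ℂ W hW j : Fin r → ℂ) i

/-- The maximal minors of an `r × k` matrix, indexed by the `k`-element subsets of the rows. -/
def maximalMinors {r k : ℕ} (M : Matrix (Fin r) (Fin k) ℂ) : (Fin k ↪o Fin r) → ℂ :=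
  fun I => (M.submatrix I id).det

theorem maximalMinors_ne_zero {r k : ℕ} (M : Matrix (Fin r) (Fin k) ℂ)
    (hM : LinearIndependent ℂ M.col) : maximalMinors M ≠ 0 := by
  have hrank : M.rank = k := by
    rw [Matrix.rank_eq_finrank_span_cols, finrank_span_eq_card hM, Fintype.card_fin]
  have hrow : Module.finrank ℂ (Submodule.span ℂ (Set.range M.row)) = k := by
    rw [← Matrix.rank_eq_finrank_span_row, hrank]
  obtain ⟨κ, a, ha, hsp, hli⟩ := exists_linearIndependent' ℂ M.row
  have : Finite κ := Finite.of_injective a ha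
  have := Fintype.ofFinite κ
  have hcard : Fintype.card κ = k := by
    rw [← hrow, ← hsp, finrank_span_eq_card hli]
  classical
  let S : Finset (Fin r) := Finset.univ.image a
  have hS : S.card = k := by
    rw [Finset.card_image_of_injective _ ha, Finset.card_univ, hcard]
  let I := S.orderEmbOfFin hS
  have hmem : ∀ j, ∃ t, a t = I j := fun j => by
    obtain ⟨t, -, ht⟩ := Finset.mem_image.mp (Finset.orderEmbOfFin_mem S hS j)
    exact ⟨t, ht⟩
  choose t ht using hmem
  have htinj : Function.Injective t := fun j j' h => I.injective (by rw [← ht, ← ht, h])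
  have hli' : LinearIndependent ℂ (M.submatrix I id).row := by
    have h2 := hli.comp t htinj
    have h3 : (M.row ∘ a) ∘ t = (M.submatrix I id).row := by
      funext j
      simp only [Function.comp_apply, ht]
      rfl
    rwa [h3] at h2
  have hdet : (M.submatrix I id).det ≠ 0 :=
    ((Matrix.isUnit_iff_isUnit_det _).mp
      (Matrix.linearIndependent_rows_iff_isUnit.mp hli')).ne_zero
  intro h
  exact hdet (congrFun h I)

/-- The Plücker point of a subspace. It does not depend on the basis, because changing the basis
multiplies all minors by the same determinant. -/
noncomputable def pluckerPoint {r k : ℕ} (W : Submodule ℂ (Fin r → ℂ))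
    (hW : Module.finrank ℂ W = k) : ℙ ℂ ((Fin k ↪o Fin r) → ℂ) :=
  Projectivization.mk ℂ (maximalMinors (basisMatrix W hW)) (maximalMinors_ne_zero _ (by
    exact (Module.finBasisOfFinrankEq ℂ W hW).linearIndependent.map' W.subtype W.ker_subtype))

/-! ## Parabolic representation pairs -/

/-- Standard generators of the fundamental group of a genus `g` surface with `n` punctures. -/
inductive SurfaceGen (g n : ℕ) : Type
  | α (j : Fin g)
  | β (j : Fin g)
  | γ (i : Fin n)

/-- The word `[α_1, β_1] ⋯ [α_g, β_g] γ_1 ⋯ γ_n`. -/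
def surfaceRelator (g n : ℕ) : FreeGroup (SurfaceGen g n) :=
  let a (j : Fin g) : FreeGroup (SurfaceGen g n) := FreeGroup.of (.α j)
  let b (j : Fin g) : FreeGroup (SurfaceGen g n) := FreeGroup.of (.β j)
  let c (i : Fin n) : FreeGroup (SurfaceGen g n) := FreeGroup.of (.γ i)
  (List.ofFn fun j => a j * b j * (a j)⁻¹ * (b j)⁻¹).prod * (List.ofFn c).prod

/-- The fundamental group of a genus `g` surface with `n` punctures, in its standard
presentation. -/
abbrev SurfaceGroup (g n : ℕ) : Type :=
  PresentedGroup ({surfaceRelator g n} : Set (FreeGroup (SurfaceGen g n)))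

/-- A standard generator as an element of the surface group. -/
def SurfaceGroup.gen {g n : ℕ} (a : SurfaceGen g n) : SurfaceGroup g n :=
  PresentedGroup.of a

/-- Parabolic representation pairs of rank `r` and type `T`: a representation of the surface group
and, at each puncture, a flag of the given type whose parabolic subgroup contains the
monodromy. -/
@[ext]
structure PRP (g : ℕ) {n r : ℕ} (T : ParabolicType n r) : Type where
  ρ : SurfaceGroup g n →* GL (Fin r) ℂ
  flag : ∀ i, TypedFlag r (T.d i)
  mem_parabolic : ∀ i, ρ (SurfaceGroup.gen (.γ i)) ∈ (flag i).parabolic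

namespace PRP

variable {g n r : ℕ} {T : ParabolicType n r}

/-- `GL_r` acts on pairs by conjugating the representation and moving the flags. -/
noncomputable instance instMulAction : MulAction (GL (Fin r) ℂ) (PRP g T) where
  smul A p :=
    { ρ := (MulAut.conj A).toMonoidHom.comp p.ρ
      flag := fun i => A • p.flag i
      mem_parabolic := fun i => by
        have h : p.ρ (SurfaceGroup.gen (.γ i)) • p.flag i = p.flag i := p.mem_parabolic i
        change (A * p.ρ (SurfaceGroup.gen (.γ i)) * A⁻¹) • (A • p.flag i) = A • p.flag i
        rw [mul_smul, inv_smul_smul, mul_smul, h] }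
  one_smul p := by
    apply PRP.ext
    · refine MonoidHom.ext fun a => ?_
      change (1 : GL (Fin r) ℂ) * p.ρ a * 1⁻¹ = p.ρ a
      simp
    · funext i
      exact one_smul _ _
  mul_smul A B p := by
    apply PRP.ext
    · refine MonoidHom.ext fun a => ?_
      change A * B * p.ρ a * (A * B)⁻¹ = A * (B * p.ρ a * B⁻¹) * A⁻¹
      group
    · funext i
      exact mul_smul _ _ _

/-- Pairs as points of a multiprojective space: the entries of the matrices `ρ(α_j)`, `ρ(β_j)`,
`ρ(γ_i)`, and the Plücker points of the proper subspaces `V^(i)_1, …, V^(i)_{s_i}`. -/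
noncomputable def coordinates (g : ℕ) {n r : ℕ} (T : ParabolicType n r) :
    Coordinates (PRP g T) where
  ι := SurfaceGen g n × Fin r × Fin r
  K := Σ i, Fin (T.s i)
  J := fun iℓ => Fin (tailSum (T.d iℓ.1) iℓ.2.succ) ↪o Fin r
  toAmbient p :=
    { aff := fun e => (p.ρ (SurfaceGroup.gen e.1) : Matrix (Fin r) (Fin r) ℂ) e.2.1 e.2.2
      proj := fun iℓ =>
        pluckerPoint ((p.flag iℓ.1).sub iℓ.2.succ) ((p.flag iℓ.1).finrank_sub iℓ.2.succ) }

end PRP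

/-! ## The star-shaped quiver with loops and its representations -/

/-- Vertices: the centre `u`, and `u^(i)_1, …, u^(i)_{s_i}` for each `i` (`leg i ℓ`, where `ℓ`
counts from `0`, is `u^(i)_{ℓ+1}`). -/
inductive StarVertex {n : ℕ} (s : Fin n → ℕ) : Type
  | center
  | leg (i : Fin n) (ℓ : Fin (s i))

/-- Arrows: `a_j`, `b_j`, `c^(i)` (loops at the centre), and for each vertex `leg i ℓ` an arrow `e`
towards the centre and a loop `c'`. -/
inductive StarArrow (g : ℕ) {n : ℕ} (s : Fin n → ℕ) : Type
  | a (j : Fin g)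
  | b (j : Fin g)
  | c (i : Fin n)
  | e (i : Fin n) (ℓ : Fin (s i))
  | c' (i : Fin n) (ℓ : Fin (s i))

/-- The vertices `u^(i)_0 = u, u^(i)_1, …, u^(i)_{s_i}` of the `i`-th leg. -/
def StarVertex.node {n : ℕ} {s : Fin n → ℕ} (i : Fin n) : Fin (s i + 1) → StarVertex s :=
  Fin.cases .center (.leg i)

namespace StarArrow

variable {g n : ℕ} {s : Fin n → ℕ}

/-- The source of an arrow. -/
def source : StarArrow g s → StarVertex s
  | a _ => .center
  | b _ => .center
  | c _ => .center
  | e i ℓ => .node i ℓ.succ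
  | c' i ℓ => .node i ℓ.succ

/-- The target of an arrow. -/
def target : StarArrow g s → StarVertex s
  | a _ => .center
  | b _ => .center
  | c _ => .center
  | e i ℓ => .node i ℓ.castSucc
  | c' i ℓ => .node i ℓ.succ

end StarArrow

/-- The dimension vector induced by a type. -/
def ParabolicType.dim {n r : ℕ} (T : ParabolicType n r) : StarVertex T.s → ℕ
  | .center => r
  | .leg i ℓ => tailSum (T.d i) ℓ.succ

/-- The affine space of representations of the quiver, `⊕_a Hom(ℂ^{d_{s(a)}}, ℂ^{d_{t(a)}})`. -/
def QuiverRep (g : ℕ) {n r : ℕ} (T : ParabolicType n r) : Type :=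
  ∀ a : StarArrow g T.s, Matrix (Fin (T.dim a.target)) (Fin (T.dim a.source)) ℂ

/-- The group `∏_v GL(d_v)`. -/
abbrev QuiverGL {n r : ℕ} (T : ParabolicType n r) : Type :=
  ∀ v : StarVertex T.s, GL (Fin (T.dim v)) ℂ

/-- The component `g_u ∈ GL_r` at the centre. -/
def QuiverGL.atCenter {n r : ℕ} {T : ParabolicType n r} (h : QuiverGL T) : GL (Fin r) ℂ :=
  h .center

/-- The subgroup `∏_{v ≠ u} GL(d_v)` of `∏_v GL(d_v)`. -/
def QuiverGL.legSubgroup {n r : ℕ} (T : ParabolicType n r) : Subgroup (QuiverGL T) where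
  carrier := {h | h .center = 1}
  one_mem' := rfl
  mul_mem' {h h'} hh hh' := by
    change h .center * h' .center = 1
    rw [show h .center = 1 from hh, show h' .center = 1 from hh', one_mul]
  inv_mem' {h} hh := by
    change (h .center)⁻¹ = 1
    rw [show h .center = 1 from hh, inv_one]

namespace QuiverRep

variable {g n r : ℕ} {T : ParabolicType n r}

/-- The action `(h • x)_a = h_{t(a)} x_a h_{s(a)}⁻¹`. -/
instance instMulAction : MulAction (QuiverGL T) (QuiverRep g T) where
  smul h x := fun a => (h a.target).val * x a * (h a.source)⁻¹.val
  one_smul x := by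
    funext a
    change ((1 : QuiverGL T) a.target).val * x a * ((1 : QuiverGL T) a.source)⁻¹.val = x a
    simp
  mul_smul h h' x := by
    funext a
    change (h a.target * h' a.target).val * x a * (h a.source * h' a.source)⁻¹.val =
      (h a.target).val * ((h' a.target).val * x a * (h' a.source)⁻¹.val) * (h a.source)⁻¹.val
    simp only [mul_inv_rev, Units.val_mul, Matrix.mul_assoc]

/-- The matrix of the loop at the node `u^(i)_ℓ`: `c^(i)` at the centre, `c^(i)_ℓ` elsewhere. -/
def loop (x : QuiverRep g T) (i : Fin n) : ∀ ℓ : Fin (T.s i + 1),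
    Matrix (Fin (T.dim (.node i ℓ))) (Fin (T.dim (.node i ℓ))) ℂ :=
  Fin.cases (x (.c i)) (fun ℓ => x (.c' i ℓ))

/-- The matrix of the arrow from `u^(i)_{ℓ+1}` to `u^(i)_ℓ`. -/
def edge (x : QuiverRep g T) (i : Fin n) (ℓ : Fin (T.s i)) :
    Matrix (Fin (T.dim (.node i ℓ.castSucc))) (Fin (T.dim (.node i ℓ.succ))) ℂ :=
  x (.e i ℓ)

/-- The composite `x_{e_1} ∘ ⋯ ∘ x_{e_ℓ} : ℂ^{d_{u_ℓ}} → ℂ^r` along the `i`-th leg. -/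
def legComposite (x : QuiverRep g T) (i : Fin n) (ℓ : Fin (T.s i + 1)) :
    Matrix (Fin r) (Fin (T.dim (.node i ℓ))) ℂ :=
  Fin.induction (motive := fun ℓ => Matrix (Fin r) (Fin (T.dim (.node i ℓ))) ℂ)
    (1 : Matrix (Fin r) (Fin r) ℂ) (fun ℓ M => M * x.edge i ℓ) ℓ

/-- The matrices of the loops at the centre. -/
def central (x : QuiverRep g T) : SurfaceGen g n → Matrix (Fin r) (Fin r) ℂ
  | .α j => x (.a j)
  | .β j => x (.b j)
  | .γ i => x (.c i)

/-- The product `[x_{a_1}, x_{b_1}] ⋯ [x_{a_g}, x_{b_g}] x_{c^(1)} ⋯ x_{c^(n)}`, where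
`[A, B] = A B A⁻¹ B⁻¹`. -/
noncomputable def relatorValue (x : QuiverRep g T) : Matrix (Fin r) (Fin r) ℂ :=
  (List.ofFn fun j : Fin g =>
      x.central (.α j) * x.central (.β j) * (x.central (.α j))⁻¹ * (x.central (.β j))⁻¹).prod *
    (List.ofFn fun i : Fin n => x.central (.γ i)).prod

/-- The matrix entries as coordinates on the affine space of representations. -/
def coordinates (g : ℕ) {n r : ℕ} (T : ParabolicType n r) : Coordinates (QuiverRep g T) where
  ι := Σ a : StarArrow g T.s, Fin (T.dim a.target) × Fin (T.dim a.source)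
  K := Empty
  J := fun _ => Empty
  toAmbient x :=
    { aff := fun e => x e.1 e.2.1 e.2.2
      proj := fun k => k.elim }

end QuiverRep

/-- The injective representations that commute along the legs and satisfy the surface relation. -/
structure IsPRPRep {g n r : ℕ} {T : ParabolicType n r} (x : QuiverRep g T) : Prop where
  injective : ∀ a, Function.Injective (Matrix.mulVecLin (x a))
  commute : ∀ i (ℓ : Fin (T.s i)),
    x.loop i ℓ.castSucc * x.edge i ℓ = x.edge i ℓ * x.loop i ℓ.succ
  relation : x.relatorValue = 1

theorem QuiverRep.loop_smul {g n r : ℕ} {T : ParabolicType n r} (h : QuiverGL T)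
    (x : QuiverRep g T) (i : Fin n) (ℓ : Fin (T.s i + 1)) :
    (h • x).loop i ℓ = (h (.node i ℓ)).val * x.loop i ℓ * (h (.node i ℓ))⁻¹.val := by
  cases ℓ using Fin.cases with
  | zero => rfl
  | succ ℓ => rfl

theorem QuiverRep.relatorValue_smul {g n r : ℕ} {T : ParabolicType n r} (h : QuiverGL T)
    (x : QuiverRep g T) :
    (h • x).relatorValue = h.atCenter.val * x.relatorValue * h.atCenter⁻¹.val := by
  let A := h.atCenter
  let conj : Matrix (Fin r) (Fin r) ℂ →* Matrix (Fin r) (Fin r) ℂ :=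
    { toFun := fun M => A.val * M * A⁻¹.val
      map_one' := by simp
      map_mul' := fun M N => by
        simp only [Matrix.mul_assoc]
        rw [← Matrix.mul_assoc A⁻¹.val A.val, ← Units.val_mul, inv_mul_cancel, Units.val_one,
          Matrix.one_mul] }
  have hinv : ∀ M, (conj M)⁻¹ = conj M⁻¹ := fun M => by
    change (A.val * M * A⁻¹.val)⁻¹ = A.val * M⁻¹ * A⁻¹.val
    rw [Matrix.mul_inv_rev, Matrix.mul_inv_rev, ← Matrix.coe_units_inv, inv_inv,
      ← Matrix.coe_units_inv, Matrix.mul_assoc]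
  have hc : ∀ a, (h • x).central a = conj (x.central a) := by
    intro a
    cases a <;> rfl
  change _ = conj x.relatorValue
  unfold QuiverRep.relatorValue
  rw [map_mul, map_list_prod, map_list_prod, List.map_ofFn, List.map_ofFn]
  simp only [hc, hinv, ← map_mul]
  rfl

theorem IsPRPRep.smul {g n r : ℕ} {T : ParabolicType n r} (h : QuiverGL T) {x : QuiverRep g T}
    (hx : IsPRPRep x) : IsPRPRep (h • x) where
  injective a := by
    change Function.Injective
      (Matrix.mulVecLin ((h a.target).val * x a * (h a.source)⁻¹.val))
    rw [Matrix.mulVecLin_mul, Matrix.mulVecLin_mul]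
    exact ((mulVecLin_GL_injective _).comp (hx.injective a)).comp (mulVecLin_GL_injective _)
  commute i ℓ := by
    have he : (h • x).edge i ℓ =
        (h (.node i ℓ.castSucc)).val * x.edge i ℓ * (h (.node i ℓ.succ))⁻¹.val := rfl
    have hcancel : ∀ v, (h v)⁻¹.val * (h v).val = 1 := fun v => by
      rw [← Units.val_mul, inv_mul_cancel, Units.val_one]
    rw [QuiverRep.loop_smul, QuiverRep.loop_smul, he]
    calc _ = (h (.node i ℓ.castSucc)).val * x.loop i ℓ.castSucc *
            ((h (.node i ℓ.castSucc))⁻¹.val * (h (.node i ℓ.castSucc)).val) * x.edge i ℓ *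
            (h (.node i ℓ.succ))⁻¹.val := by simp only [Matrix.mul_assoc]
      _ = (h (.node i ℓ.castSucc)).val * (x.loop i ℓ.castSucc * x.edge i ℓ) *
            (h (.node i ℓ.succ))⁻¹.val := by rw [hcancel]; simp only [Matrix.mul_assoc, Matrix.one_mul]
      _ = (h (.node i ℓ.castSucc)).val * (x.edge i ℓ * x.loop i ℓ.succ) *
            (h (.node i ℓ.succ))⁻¹.val := by rw [hx.commute]
      _ = (h (.node i ℓ.castSucc)).val * x.edge i ℓ *
            ((h (.node i ℓ.succ))⁻¹.val * (h (.node i ℓ.succ)).val) * x.loop i ℓ.succ *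
            (h (.node i ℓ.succ))⁻¹.val := by rw [hcancel]; simp only [Matrix.mul_assoc, Matrix.one_mul]
      _ = _ := by simp only [Matrix.mul_assoc]
  relation := by
    rw [QuiverRep.relatorValue_smul, hx.relation, Matrix.mul_one, ← Units.val_mul, mul_inv_cancel,
      Units.val_one]

/-- The set of these representations. -/
abbrev PRPRep (g : ℕ) {n r : ℕ} (T : ParabolicType n r) : Type :=
  {x : QuiverRep g T // IsPRPRep x}

namespace PRPRep

variable {g n r : ℕ} {T : ParabolicType n r}

/-- The restriction of the action of `∏_v GL(d_v)`. -/
instance instMulAction : MulAction (QuiverGL T) (PRPRep g T) where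
  smul h x := ⟨h • x.1, x.2.smul h⟩
  one_smul x := Subtype.ext (one_smul _ x.1)
  mul_smul h h' x := Subtype.ext (mul_smul h h' x.1)

/-- The coordinates of the affine space of representations, restricted. -/
def coordinates (g : ℕ) {n r : ℕ} (T : ParabolicType n r) : Coordinates (PRPRep g T) where
  ι := (QuiverRep.coordinates g T).ι
  K := (QuiverRep.coordinates g T).K
  J := (QuiverRep.coordinates g T).J
  toAmbient x := (QuiverRep.coordinates g T).toAmbient x.1

end PRPRep

/-! ## Functions that are quotients of multihomogeneous polynomials -/

namespace Ambient

variable {ι K : Type} {J : K → Type}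

/-! The map sends a representation of the quiver to its matrices at the centre and to the images of
the composites along the legs. The commuting squares make these images stable under the monodromy
(`central_mul_legComposite`), and their Plücker coordinates are maximal minors of the composites,
hence polynomials in the matrix entries; so the map is a morphism (`hasFractionLift_toPRP`). The
group at the centre conjugates and moves the flags, while the groups on the legs only change bases
of the subspaces. Conversely, two injective matrices with the same column space differ by an
invertible change of basis, and a representation is determined by its central matrices and
composites (`IsPRPRep.ext`), so fibres are orbits (`exists_smul_eq_of_toPRP_eq`).

The rest follows from Zariski-local sections (`of_local_sections`): pulling back along a section
shows that a set with open preimage is open and that an invariant regular function descends to a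
regular one. Sections come from the standard charts of Grassmannians. Where a chosen Plücker
coordinate of each subspace is nonzero, the subspace has a unique basis matrix with identity rows in
the chosen positions, and its entries are, up to sign, ratios of Plücker coordinates
(`chartMatrix_pluckerPoint`). Writing inclusions and monodromy in these bases gives a representation
of the quiver whose entries are regular on the chart (`Chart.quiverRep`).

The same charts show that the pairs form a locally closed set: on a chart, a point of the ambient
variety comes from a pair exactly when it satisfies `Chart.Equations`. For representations of the
quiver, injectivity is an open condition on minors and the remaining conditions are closed there. -/

theorem isMultihomogeneous_C (z : ℂ) :
    IsMultihomogeneous (ι := ι) (J := J) (MvPolynomial.C z) 0 :=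
  MvPolynomial.isWeightedHomogeneous_C _ z

theorem isMultihomogeneous_X (e : ι ⊕ (Σ k, J k)) :
    IsMultihomogeneous (MvPolynomial.X e) (multidegree e) :=
  MvPolynomial.isWeightedHomogeneous_X ℂ _ e

@[simp] theorem evalAt_C (z : ℂ) (p : Ambient ι K J) : evalAt (MvPolynomial.C z) p = z := by
  simp [evalAt]

theorem evalAt_add (F G : MvPolynomial (ι ⊕ (Σ k, J k)) ℂ) (p : Ambient ι K J) :
    evalAt (F + G) p = evalAt F p + evalAt G p := by
  simp [evalAt]

theorem evalAt_mul (F G : MvPolynomial (ι ⊕ (Σ k, J k)) ℂ) (p : Ambient ι K J) :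
    evalAt (F * G) p = evalAt F p * evalAt G p := by
  simp [evalAt]

/-- Rescaling the homogeneous coordinates multiplies all multihomogeneous polynomials of
multidegree `m` by the same factor. -/
theorem evalAt_eq_of_proportional {F : MvPolynomial (ι ⊕ (Σ k, J k)) ℂ} {m : K →₀ ℕ}
    (hF : IsMultihomogeneous F m) (p : Ambient ι K J) (v : ι ⊕ (Σ k, J k) → ℂ) (u : K → ℂ)
    (haff : ∀ e, p.aff e = v (.inl e)) (hproj : ∀ k j, (p.proj k).rep j = u k * v (.inr ⟨k, j⟩)) :
    evalAt F p = (m.prod fun k e => u k ^ e) * MvPolynomial.eval v F := by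
  let s : ι ⊕ (Σ k, J k) → ℂ := Sum.elim (fun _ => 1) (fun kj => u kj.1)
  have hs : (Sum.elim p.aff (fun kj => (p.proj kj.1).rep kj.2) : ι ⊕ (Σ k, J k) → ℂ) =
      fun e => s e * v e := by
    funext e
    rcases e with e | ⟨k, j⟩
    · simp [s, haff]
    · simp [s, hproj]
  -- The scaling factor of a monomial depends only on its multidegree; both sides are multiplicative
  -- in `d`, so single variables suffice.
  have hweight : ∀ d : (ι ⊕ (Σ k, J k)) →₀ ℕ, (d.prod fun e a => s e ^ a) =
      (Finsupp.weight multidegree d).prod fun k a => u k ^ a := by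
    intro d
    induction d using Finsupp.induction_linear with
    | zero => simp
    | add d d' hd hd' =>
      rw [Finsupp.prod_add_index' (by simp) (by simp [pow_add]), hd, hd', map_add,
        Finsupp.prod_add_index' (by simp) (by simp [pow_add])]
    | single e a =>
      rcases e with e | ⟨k, j⟩
      · simp [s, multidegree, Finsupp.weight_single]
      · simp [s, multidegree, Finsupp.weight_single]
  rw [evalAt, hs, MvPolynomial.eval_eq, MvPolynomial.eval_eq, Finset.mul_sum]
  refine Finset.sum_congr rfl fun d hd => ?_
  rw [← hF (MvPolynomial.mem_support_iff.mp hd), ← hweight d, Finsupp.prod]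
  simp only [mul_pow, Finset.prod_mul_distrib]
  ring

theorem isOpen_evalAt_ne_zero {F : MvPolynomial (ι ⊕ (Σ k, J k)) ℂ} {m : K →₀ ℕ}
    (hF : IsMultihomogeneous F m) : IsOpen {p : Ambient ι K J | evalAt F p ≠ 0} :=
  TopologicalSpace.isOpen_generateFrom_of_mem ⟨F, m, hF, rfl⟩

/-- The tautological coordinates on an ambient variety. -/
def selfCoordinates (ι K : Type) (J : K → Type) : Coordinates (Ambient ι K J) where
  ι := ι
  K := K
  J := J
  toAmbient := id

theorem topology_selfCoordinates :
    (selfCoordinates ι K J).topology = Ambient.zariski :=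
  induced_id

end Ambient

namespace Coordinates

variable {X Y : Type}

theorem isOpen_evalAt_ne_zero (c : Coordinates X) {F : MvPolynomial (c.ι ⊕ (Σ k, c.J k)) ℂ}
    {m : c.K →₀ ℕ} (hF : Ambient.IsMultihomogeneous F m) :
    IsOpen[c.topology] {q | Ambient.evalAt F (c.toAmbient q) ≠ 0} :=
  ⟨_, Ambient.isOpen_evalAt_ne_zero hF, rfl⟩

/-- The functions that are, on `W`, a quotient of two multihomogeneous polynomials of the same
multidegree. -/
def fractions (c : Coordinates X) (W : Set X) : Subalgebra ℂ (X → ℂ) where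
  carrier := {f | ∃ F G m, Ambient.IsMultihomogeneous F m ∧ Ambient.IsMultihomogeneous G m ∧
    ∀ q ∈ W, Ambient.evalAt G (c.toAmbient q) ≠ 0 ∧
      f q = Ambient.evalAt F (c.toAmbient q) / Ambient.evalAt G (c.toAmbient q)}
  mul_mem' := by
    rintro f f' ⟨F, G, m, hF, hG, h⟩ ⟨F', G', m', hF', hG', h'⟩
    refine ⟨F * F', G * G', m + m', hF.mul hF', hG.mul hG', fun q hq => ?_⟩
    obtain ⟨h1, h2⟩ := h q hq
    obtain ⟨h1', h2'⟩ := h' q hq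
    rw [Ambient.evalAt_mul, Ambient.evalAt_mul, Pi.mul_apply, h2, h2']
    exact ⟨mul_ne_zero h1 h1', by field_simp⟩
  add_mem' := by
    rintro f f' ⟨F, G, m, hF, hG, h⟩ ⟨F', G', m', hF', hG', h'⟩
    refine ⟨F * G' + G * F', G * G', m + m', (hF.mul hG').add (hG.mul hF'), hG.mul hG',
      fun q hq => ?_⟩
    obtain ⟨h1, h2⟩ := h q hq
    obtain ⟨h1', h2'⟩ := h' q hq
    rw [Ambient.evalAt_mul, Ambient.evalAt_add, Ambient.evalAt_mul, Ambient.evalAt_mul,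
      Pi.add_apply, h2, h2']
    exact ⟨mul_ne_zero h1 h1', by field_simp⟩
  algebraMap_mem' z :=
    ⟨MvPolynomial.C z, MvPolynomial.C 1, 0, Ambient.isMultihomogeneous_C z,
      Ambient.isMultihomogeneous_C 1, fun q _ => by simp only [Ambient.evalAt_C]; simp⟩

variable {c : Coordinates X} {W W' : Set X}

theorem mem_fractions {f : X → ℂ} : f ∈ c.fractions W ↔
    ∃ F G m, Ambient.IsMultihomogeneous F m ∧ Ambient.IsMultihomogeneous G m ∧
      ∀ q ∈ W, Ambient.evalAt G (c.toAmbient q) ≠ 0 ∧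
        f q = Ambient.evalAt F (c.toAmbient q) / Ambient.evalAt G (c.toAmbient q) :=
  Iff.rfl

theorem fractions_congr {f f' : X → ℂ} (hf : f ∈ c.fractions W) (h : ∀ q ∈ W, f' q = f q) :
    f' ∈ c.fractions W := by
  obtain ⟨F, G, m, hF, hG, hq⟩ := hf
  exact ⟨F, G, m, hF, hG, fun q hqW => ⟨(hq q hqW).1, (h q hqW).trans (hq q hqW).2⟩⟩

theorem fractions_anti (h : W' ⊆ W) : c.fractions W ≤ c.fractions W' :=
  fun _ ⟨F, G, m, hF, hG, hq⟩ => ⟨F, G, m, hF, hG, fun q hqW => hq q (h hqW)⟩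

theorem inv_mem_fractions {f : X → ℂ} (hf : f ∈ c.fractions W) (h0 : ∀ q ∈ W, f q ≠ 0) :
    f⁻¹ ∈ c.fractions W := by
  obtain ⟨F, G, m, hF, hG, hq⟩ := hf
  refine ⟨G, F, m, hG, hF, fun q hqW => ⟨fun h => h0 q hqW ?_, ?_⟩⟩
  · rw [(hq q hqW).2, h, zero_div]
  · rw [Pi.inv_apply, (hq q hqW).2, inv_div]

theorem aff_mem_fractions (c : Coordinates X) (W : Set X) (e : c.ι) :
    (fun q => (c.toAmbient q).aff e) ∈ c.fractions W :=
  ⟨MvPolynomial.X (.inl e), MvPolynomial.C 1, 0, Ambient.isMultihomogeneous_X _,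
    Ambient.isMultihomogeneous_C 1, fun q _ => by simp [Ambient.evalAt]⟩

/-- A single homogeneous coordinate is not a function; a ratio of two from the same projective
factor is, since their multidegrees agree. -/
theorem proj_div_mem_fractions {k : c.K} {i : c.J k}
    (h : ∀ q ∈ W, ((c.toAmbient q).proj k).rep i ≠ 0) (j : c.J k) :
    (fun q => ((c.toAmbient q).proj k).rep j / ((c.toAmbient q).proj k).rep i) ∈
      c.fractions W :=
  ⟨MvPolynomial.X (.inr ⟨k, j⟩), MvPolynomial.X (.inr ⟨k, i⟩), _,
    Ambient.isMultihomogeneous_X _, Ambient.isMultihomogeneous_X _,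
    fun q hq => by simpa [Ambient.evalAt] using h q hq⟩

theorem isOpen_proj_ne_zero (c : Coordinates X) (k : c.K) (i : c.J k) :
    IsOpen[c.topology] {q | ((c.toAmbient q).proj k).rep i ≠ 0} := by
  have := c.isOpen_evalAt_ne_zero (Ambient.isMultihomogeneous_X (.inr ⟨k, i⟩))
  simpa [Ambient.evalAt] using this

theorem eval_mem_fractions {σ : Type} {v : σ → X → ℂ} (hv : ∀ e, v e ∈ c.fractions W)
    (F : MvPolynomial σ ℂ) : (fun q => MvPolynomial.eval (fun e => v e q) F) ∈ c.fractions W := by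
  induction F using MvPolynomial.induction_on with
  | C z => exact fractions_congr ((c.fractions W).algebraMap_mem z) fun q _ => by simp
  | add F G hF hG => exact fractions_congr (add_mem hF hG) fun q _ => by simp
  | mul_X F e hF => exact fractions_congr (mul_mem hF (hv e)) fun q _ => by simp

theorem exists_isOpen_of_mem_fractions {f : X → ℂ} (hf : f ∈ c.fractions W) :
    ∃ O : Set X, IsOpen[c.topology] O ∧ ∀ q ∈ W, f q ≠ 0 ↔ q ∈ O := by
  obtain ⟨F, G, m, hF, hG, hq⟩ := hf
  refine ⟨_, c.isOpen_evalAt_ne_zero hF, fun q hqW => ?_⟩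
  rw [(hq q hqW).2, Set.mem_ofPred_eq, div_ne_zero_iff]
  exact and_iff_left (hq q hqW).1

theorem isOpen_ne_zero_of_mem_fractions {f : X → ℂ} (hW : IsOpen[c.topology] W)
    (hf : f ∈ c.fractions W) : IsOpen[c.topology] {q ∈ W | f q ≠ 0} := by
  obtain ⟨O, hO, h⟩ := exists_isOpen_of_mem_fractions hf
  have : {q ∈ W | f q ≠ 0} = W ∩ O := Set.ext fun q => and_congr_right fun hq => h q hq
  rw [this]
  exact @IsOpen.inter X c.topology _ _ hW hO

theorem isRegularOn_iff {U : Set X} {f : X → ℂ} : c.IsRegularOn U f ↔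
    ∀ p ∈ U, ∃ W : Set X, IsOpen[c.topology] W ∧ p ∈ W ∧ f ∈ c.fractions (W ∩ U) :=
  Iff.rfl

/-! ### Matrices of fractions -/

/-- All entries of the matrix-valued function `M` are fractions on `W`. -/
def IsFractionMatrix (c : Coordinates X) (W : Set X) {m n : Type}
    (M : X → Matrix m n ℂ) : Prop :=
  ∀ i j, (fun q => M q i j) ∈ c.fractions W

namespace IsFractionMatrix

variable {l m n : Type}

theorem const (A : Matrix m n ℂ) : c.IsFractionMatrix W fun _ => A :=
  fun i j => (c.fractions W).algebraMap_mem (A i j)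

theorem submatrix {M : X → Matrix m n ℂ} (hM : c.IsFractionMatrix W M) {m' n' : Type}
    (e : m' → m) (e' : n' → n) : c.IsFractionMatrix W fun q => (M q).submatrix e e' :=
  fun i j => hM (e i) (e' j)

theorem mul [Fintype m] {M : X → Matrix l m ℂ} {N : X → Matrix m n ℂ}
    (hM : c.IsFractionMatrix W M) (hN : c.IsFractionMatrix W N) :
    c.IsFractionMatrix W fun q => M q * N q := fun i j => by
  have : (fun q => (M q * N q) i j) = ∑ k, (fun q => M q i k) * (fun q => N q k j) := by
    funext q
    simp [Matrix.mul_apply]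
  rw [this]
  exact sum_mem fun k _ => mul_mem (hM i k) (hN k j)

theorem det [Fintype n] [DecidableEq n] {M : X → Matrix n n ℂ} (hM : c.IsFractionMatrix W M) :
    (fun q => (M q).det) ∈ c.fractions W := by
  have : (fun q => (M q).det) =
      ∑ σ : Equiv.Perm n, Equiv.Perm.sign σ • ∏ i, fun q => M q (σ i) i := by
    funext q
    simp [Matrix.det_apply]
  rw [this]
  refine sum_mem fun σ _ => ?_
  rw [Units.smul_def]
  exact zsmul_mem (prod_mem fun i _ => hM (σ i) i) _

theorem inv [Fintype n] [DecidableEq n] {M : X → Matrix n n ℂ} (hM : c.IsFractionMatrix W M)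
    (h0 : ∀ q ∈ W, (M q).det ≠ 0) : c.IsFractionMatrix W fun q => (M q)⁻¹ := fun i j => by
  have hadj : (fun q => (M q).adjugate i j) ∈ c.fractions W := by
    -- An adjugate entry is the determinant of `M` with row `j` replaced by a constant unit vector.
    have : c.IsFractionMatrix W fun q => (M q).updateRow j (Pi.single i 1) := fun a b => by
      by_cases hab : a = j
      · subst hab
        exact fractions_congr ((c.fractions W).algebraMap_mem ((Pi.single i 1 : n → ℂ) b))
          fun q _ => by simp
      · simpa [Matrix.updateRow_ne hab] using hM a b
    simpa only [Matrix.adjugate_apply] using this.det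
  refine fractions_congr (mul_mem (inv_mem_fractions hM.det h0) hadj) fun q _ => ?_
  simp [Matrix.inv_def]

theorem list_prod [Fintype n] [DecidableEq n] {N : ℕ} {M : Fin N → X → Matrix n n ℂ}
    (hM : ∀ i, c.IsFractionMatrix W (M i)) :
    c.IsFractionMatrix W fun q => (List.ofFn fun i => M i q).prod := by
  induction N with
  | zero => simpa using const 1
  | succ N ih =>
    simpa only [List.ofFn_succ, List.prod_cons] using (hM 0).mul (ih fun i => hM i.succ)

end IsFractionMatrix

/-! ### Morphisms given by homogeneous coordinates -/

/-- On `W`, homogeneous coordinates of `f` are given by fractions. -/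
def HasFractionLift (cX : Coordinates X) (cY : Coordinates Y) (W : Set X) (f : X → Y) : Prop :=
  ∃ v : cY.ι ⊕ (Σ k, cY.J k) → X → ℂ, (∀ e, v e ∈ cX.fractions W) ∧
    ∀ q ∈ W, (∀ e, (cY.toAmbient (f q)).aff e = v (.inl e) q) ∧
      ∀ k, ∃ u : ℂ, u ≠ 0 ∧ ∀ j, ((cY.toAmbient (f q)).proj k).rep j = u * v (.inr ⟨k, j⟩) q

namespace HasFractionLift

variable {cX : Coordinates X} {cY : Coordinates Y} {f : X → Y}

/-- The scalar `z` depends on the point and the multidegree but not on `F`: it does not affect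
non-vanishing, and it cancels in quotients of equal multidegree. -/
theorem exists_evalAt_eq (hf : HasFractionLift cX cY W f) :
    ∃ v : cY.ι ⊕ (Σ k, cY.J k) → X → ℂ, (∀ e, v e ∈ cX.fractions W) ∧
      ∀ q ∈ W, ∀ m : cY.K →₀ ℕ, ∃ z : ℂ, z ≠ 0 ∧ ∀ F, Ambient.IsMultihomogeneous F m →
        Ambient.evalAt F (cY.toAmbient (f q)) = z * MvPolynomial.eval (fun e => v e q) F := by
  obtain ⟨v, hv, h⟩ := hf
  refine ⟨v, hv, fun q hq m => ?_⟩
  obtain ⟨haff, hproj⟩ := h q hq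
  choose u hu hproj using hproj
  exact ⟨_, Finset.prod_ne_zero_iff.mpr fun k _ => pow_ne_zero _ (hu k),
    fun F hF => Ambient.evalAt_eq_of_proportional hF _ _ u haff hproj⟩

theorem isOpen_inter_preimage (hf : HasFractionLift cX cY W f) (hW : IsOpen[cX.topology] W)
    {V : Set Y} (hV : IsOpen[cY.topology] V) : IsOpen[cX.topology] (W ∩ f ⁻¹' V) := by
  let _ := cX.topology
  obtain ⟨v, hv, h⟩ := hf.exists_evalAt_eq
  obtain ⟨O, hO, rfl⟩ := hV
  -- The topology is generated by non-vanishing loci, so induction on generation reduces to one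
  -- polynomial, whose pullback is a fraction up to a nonzero scalar.
  induction hO with
  | basic O hO =>
    obtain ⟨F, m, hF, rfl⟩ := hO
    convert isOpen_ne_zero_of_mem_fractions hW (eval_mem_fractions hv F) using 1
    ext q
    refine and_congr_right fun hq => ?_
    obtain ⟨z, hz, h⟩ := h q hq m
    simp [h F hF, hz]
  | univ => simpa using hW
  | inter O O' _ _ h1 h2 =>
    convert h1.inter h2 using 1
    ext q
    simp only [Set.mem_inter_iff, Set.mem_preimage]
    tauto
  | sUnion S _ h1 =>
    convert isOpen_biUnion h1 using 1
    ext q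
    simp only [Set.mem_inter_iff, Set.mem_preimage, Set.mem_sUnion, Set.mem_iUnion]
    tauto

theorem isRegularOn_comp (hf : HasFractionLift cX cY W f) (hW : IsOpen[cX.topology] W)
    {V : Set Y} {h : Y → ℂ} (hh : cY.IsRegularOn V h) :
    cX.IsRegularOn (W ∩ f ⁻¹' V) (h ∘ f) := by
  rintro p ⟨hpW, hpV⟩
  obtain ⟨O, hO, hpO, F, G, m, hF, hG, hFG⟩ := hh (f p) hpV
  refine ⟨_, hf.isOpen_inter_preimage hW hO, ⟨hpW, hpO⟩, ?_⟩
  obtain ⟨v, hv, hz⟩ := hf.exists_evalAt_eq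
  have hF' := fractions_anti (W' := W ∩ f ⁻¹' O ∩ (W ∩ f ⁻¹' V)) (fun q hq => hq.1.1)
    (eval_mem_fractions hv F)
  have hG' := fractions_anti (W' := W ∩ f ⁻¹' O ∩ (W ∩ f ⁻¹' V)) (fun q hq => hq.1.1)
    (eval_mem_fractions hv G)
  refine mem_fractions.mp (fractions_congr (mul_mem hF' (inv_mem_fractions hG' ?_)) ?_)
  · rintro q ⟨⟨hqW, hqO⟩, -, hqV⟩ h0
    obtain ⟨z, -, hz⟩ := hz q hqW m
    exact (hFG (f q) ⟨hqO, hqV⟩).1 (by rw [hz G hG, h0, mul_zero])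
  · rintro q ⟨⟨hqW, hqO⟩, -, hqV⟩
    obtain ⟨z, hz0, hz⟩ := hz q hqW m
    rw [Function.comp_apply, (hFG (f q) ⟨hqO, hqV⟩).2, hz F hF, hz G hG,
      mul_div_mul_left _ _ hz0, Pi.mul_apply, Pi.inv_apply, div_eq_mul_inv]

theorem isMorphism (hf : HasFractionLift cX cY Set.univ f) : IsMorphism cX cY f := by
  let _ := cX.topology
  let _ := cY.topology
  refine ⟨continuous_def.mpr fun V hV => ?_, fun V h _ hh => ?_⟩
  · simpa using hf.isOpen_inter_preimage isOpen_univ hV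
  · simpa using hf.isRegularOn_comp isOpen_univ hh

end HasFractionLift

/-! ### Conditions that are closed on a subset -/

/-- On `W`, the condition `P` defines a relatively closed subset. -/
def IsClosedOn (c : Coordinates X) (W : Set X) (P : X → Prop) : Prop :=
  ∃ Z : Set X, IsClosed[c.topology] Z ∧ ∀ q ∈ W, P q ↔ q ∈ Z

namespace IsClosedOn

theorem congr {P P' : X → Prop} (hP : c.IsClosedOn W P) (h : ∀ q ∈ W, P' q ↔ P q) :
    c.IsClosedOn W P' := by
  obtain ⟨Z, hZ, hZP⟩ := hP
  exact ⟨Z, hZ, fun q hq => (h q hq).trans (hZP q hq)⟩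

theorem and {P P' : X → Prop} (hP : c.IsClosedOn W P) (hP' : c.IsClosedOn W P') :
    c.IsClosedOn W fun q => P q ∧ P' q := by
  obtain ⟨Z, hZ, h⟩ := hP
  obtain ⟨Z', hZ', h'⟩ := hP'
  exact ⟨Z ∩ Z', @IsClosed.inter X _ _ c.topology hZ hZ',
    fun q hq => and_congr (h q hq) (h' q hq)⟩

theorem forall_mem {E : Sort*} {P : E → X → Prop} (hP : ∀ e, c.IsClosedOn W (P e)) :
    c.IsClosedOn W fun q => ∀ e, P e q := by
  choose Z hZ h using hP
  refine ⟨⋂ e, Z e, @isClosed_iInter X _ c.topology Z hZ, fun q hq => ?_⟩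
  rw [Set.mem_iInter]
  exact forall_congr' fun e => h e q hq

/-- On `W` the equation says that the numerator of `f - f'` vanishes; the zero locus of that
numerator is closed in all of `X`. -/
theorem eq_of_mem_fractions {f f' : X → ℂ} (hf : f ∈ c.fractions W)
    (hf' : f' ∈ c.fractions W) : c.IsClosedOn W fun q => f q = f' q := by
  obtain ⟨O, hO, h⟩ := exists_isOpen_of_mem_fractions (sub_mem hf hf')
  refine ⟨Oᶜ, (@isClosed_compl_iff X c.topology O).mpr hO, fun q hq => ?_⟩
  rw [Set.mem_compl_iff, ← h q hq, not_not, Pi.sub_apply, sub_eq_zero]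

end IsClosedOn

theorem IsFractionMatrix.isClosedOn_eq {m n : Type} {M M' : X → Matrix m n ℂ}
    (hM : c.IsFractionMatrix W M) (hM' : c.IsFractionMatrix W M') :
    c.IsClosedOn W fun q => M q = M' q :=
  (IsClosedOn.forall_mem fun i => IsClosedOn.forall_mem fun j =>
    IsClosedOn.eq_of_mem_fractions (hM i j) (hM' i j)).congr fun _ _ => Matrix.ext_iff.symm

end Coordinates

/-- Local closedness can be tested near each point of `S`, in the form `W ∩ closure S ⊆ S`. For open
`W`, every point of `W ∩ closure S` lies in the closure of `W ∩ S`, which stays inside the closed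
set cutting out `S` on `W`. -/
theorem Ambient.isLocallyClosed_of_isClosedOn {ι K : Type} {J : K → Type}
    {S : Set (Ambient ι K J)} (h : ∀ p ∈ S, ∃ W : Set (Ambient ι K J), IsOpen W ∧ p ∈ W ∧
      (Ambient.selfCoordinates ι K J).IsClosedOn W (· ∈ S)) : IsLocallyClosed S := by
  refine ((isLocallyClosed_tfae S).out 0 3).mpr fun p hp => ?_
  obtain ⟨W, hW, hpW, Z, hZ, hWZ⟩ := h p hp
  rw [Ambient.topology_selfCoordinates] at hZ
  refine ⟨W, hpW, hW, fun q hq => (hWZ q hq.1).mpr ?_⟩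
  have hsub : W ∩ S ⊆ Z := fun q hq => (hWZ q hq.1).mp hq.2
  exact closure_minimal hsub hZ (hW.inter_closure hq)

/-! ## Injective matrices and their column spaces -/

theorem Matrix.mul_left_cancel_of_injective {l m n : Type} [Fintype m] [Fintype n]
    {M : Matrix l m ℂ}
    (hM : Function.Injective (Matrix.mulVecLin M)) {N N' : Matrix m n ℂ} (h : M * N = M * N') :
    N = N' := by
  classical
  have : N.mulVecLin = N'.mulVecLin := LinearMap.ext fun v => hM <| by
    have := congrArg (fun A => Matrix.mulVecLin A v) h
    rwa [Matrix.mulVecLin_mul, Matrix.mulVecLin_mul] at this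
  exact Matrix.toLin'.injective this

theorem Matrix.injective_of_mul {l m n : Type} [Fintype m] [Fintype n] {M : Matrix l m ℂ}
    {N : Matrix m n ℂ} (h : Function.Injective (Matrix.mulVecLin (M * N))) :
    Function.Injective (Matrix.mulVecLin N) := by
  rw [Matrix.mulVecLin_mul, LinearMap.coe_comp] at h
  exact h.of_comp

theorem Matrix.injective_mul {l m n : Type} [Fintype m] [Fintype n] {M : Matrix l m ℂ}
    {N : Matrix m n ℂ} (hM : Function.Injective (Matrix.mulVecLin M))
    (hN : Function.Injective (Matrix.mulVecLin N)) :
    Function.Injective (Matrix.mulVecLin (M * N)) := by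
  rw [Matrix.mulVecLin_mul, LinearMap.coe_comp]
  exact hM.comp hN

theorem Matrix.injective_iff_det_ne_zero {n : Type} [Fintype n] [DecidableEq n]
    {M : Matrix n n ℂ} : Function.Injective (Matrix.mulVecLin M) ↔ M.det ≠ 0 := by
  rw [← isUnit_iff_ne_zero, ← Matrix.isUnit_iff_isUnit_det]
  exact Matrix.mulVec_injective_iff_isUnit

theorem Matrix.range_mul_GL {m n : Type} [Fintype n] [DecidableEq n] (M : Matrix m n ℂ)
    (A : GL n ℂ) : LinearMap.range (M * (A : Matrix n n ℂ)).mulVecLin =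
      LinearMap.range M.mulVecLin := by
  refine le_antisymm ?_ ?_
  · rw [Matrix.mulVecLin_mul]
    exact LinearMap.range_comp_le_range _ _
  · have : M = M * (A : Matrix n n ℂ) * (A⁻¹ : GL n ℂ).val := by
      rw [Matrix.mul_assoc, ← Units.val_mul, mul_inv_cancel, Units.val_one, Matrix.mul_one]
    conv_lhs => rw [this, Matrix.mulVecLin_mul]
    exact LinearMap.range_comp_le_range _ _

theorem Matrix.exists_eq_mul_of_range_le {l m n : Type} [Fintype m] [Fintype n]
    {M : Matrix l m ℂ} {N : Matrix l n ℂ}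
    (h : LinearMap.range M.mulVecLin ≤ LinearMap.range N.mulVecLin) :
    ∃ A : Matrix n m ℂ, M = N * A := by
  classical
  have : ∀ j, ∃ v, N.mulVecLin v = M.col j := fun j =>
    h ⟨Pi.single j 1, by rw [Matrix.mulVecLin_apply, Matrix.mulVec_single_one]⟩
  choose v hv using this
  refine ⟨Matrix.of fun i j => v j i, Matrix.ext fun i j => ?_⟩
  exact (congrFun (hv j) i).symm

/-- The transition matrix is square, and it is injective because `M` is; hence it is invertible. -/
theorem Matrix.exists_GL_of_range_eq {m n : Type} [Fintype n] [DecidableEq n]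
    {M N : Matrix m n ℂ} (hM : Function.Injective M.mulVecLin)
    (h : LinearMap.range M.mulVecLin = LinearMap.range N.mulVecLin) :
    ∃ A : GL n ℂ, M = N * A.val := by
  obtain ⟨A, hA⟩ := Matrix.exists_eq_mul_of_range_le h.le
  have hdet : A.det ≠ 0 :=
    Matrix.injective_iff_det_ne_zero.mp (Matrix.injective_of_mul (hA ▸ hM))
  exact ⟨Matrix.GeneralLinearGroup.mkOfDetNeZero A hdet, hA⟩

/-! ## Plücker coordinates in a chart -/

theorem Projectivization.eq_of_rep_eq_smul {V : Type} [AddCommGroup V] [Module ℂ V] {p p' : ℙ ℂ V}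
    {u : ℂ} (h : p.rep = u • p'.rep) : p = p' := by
  rw [← p.mk_rep, ← p'.mk_rep, Projectivization.mk_eq_mk_iff']
  exact ⟨u, h.symm⟩

section Plucker

variable {r k : ℕ}

theorem maximalMinors_mul (M : Matrix (Fin r) (Fin k) ℂ) (A : Matrix (Fin k) (Fin k) ℂ) :
    maximalMinors (M * A) = A.det • maximalMinors M := by
  funext I
  have : (M * A).submatrix I id = M.submatrix I id * A := rfl
  simp [maximalMinors, this, mul_comm]

theorem exists_maximalMinors_ne_zero {M : Matrix (Fin r) (Fin k) ℂ}
    (hM : Function.Injective M.mulVecLin) : ∃ I, maximalMinors M I ≠ 0 :=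
  Function.ne_iff.mp (maximalMinors_ne_zero M (Matrix.mulVec_injective_iff.mp hM))

theorem injective_of_det_submatrix_ne_zero {M : Matrix (Fin r) (Fin k) ℂ} {I : Fin k → Fin r}
    (h : (M.submatrix I id).det ≠ 0) : Function.Injective M.mulVecLin := by
  have h1 := Matrix.injective_iff_det_ne_zero.mpr h
  intro v w hvw
  refine h1 (funext fun i => ?_)
  exact congrFun hvw (I i)

theorem range_basisMatrix (W : Submodule ℂ (Fin r → ℂ)) (hW : Module.finrank ℂ W = k) :
    LinearMap.range (basisMatrix W hW).mulVecLin = W := by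
  have hcol : (basisMatrix W hW).col =
      W.subtype ∘ Module.finBasisOfFinrankEq ℂ W hW := rfl
  rw [Matrix.range_mulVecLin, hcol, Set.range_comp, Submodule.span_image, Module.Basis.span_eq,
    Submodule.map_top, Submodule.range_subtype]

/-- The Plücker coordinates of a column space are the maximal minors. -/
theorem pluckerPoint_rep_eq {W : Submodule ℂ (Fin r → ℂ)} (hW : Module.finrank ℂ W = k)
    {M : Matrix (Fin r) (Fin k) ℂ} (hMW : LinearMap.range M.mulVecLin = W) :
    ∃ u : ℂ, u ≠ 0 ∧ (pluckerPoint W hW).rep = u • maximalMinors M := by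
  have hB : Function.Injective (basisMatrix W hW).mulVecLin := Matrix.mulVec_injective_iff.mpr
    ((Module.finBasisOfFinrankEq ℂ W hW).linearIndependent.map' W.subtype W.ker_subtype)
  obtain ⟨A, hA⟩ := Matrix.exists_GL_of_range_eq hB ((range_basisMatrix W hW).trans hMW.symm)
  have hdet : A.val.det ≠ 0 := ((Matrix.isUnit_iff_isUnit_det _).mp A.isUnit).ne_zero
  have hne : maximalMinors (basisMatrix W hW) ≠ 0 := by
    obtain ⟨I, hI⟩ := exists_maximalMinors_ne_zero hB
    exact fun h => hI (congrFun h I)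
  obtain ⟨a, ha⟩ := Projectivization.exists_smul_eq_mk_rep ℂ _ hne
  refine ⟨a * A.val.det, mul_ne_zero a.ne_zero hdet, ?_⟩
  rw [pluckerPoint, ← ha, mul_smul, ← maximalMinors_mul, ← hA]
  rfl

/-- Minors with rows in arbitrary order are, up to a sign, zero or maximal minors. -/
theorem exists_det_submatrix_eq (I : Fin k ↪o Fin r) (J : Fin k → Fin r) :
    ∃ (z : ℂ) (J' : Fin k ↪o Fin r), ∀ M : Matrix (Fin r) (Fin k) ℂ,
      (M.submatrix J id).det = z * maximalMinors M J' := by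
  by_cases hJ : Function.Injective J
  · have hcard : (Finset.univ.image J).card = k := by
      rw [Finset.card_image_of_injective _ hJ, Finset.card_univ, Fintype.card_fin]
    let J' := (Finset.univ.image J).orderEmbOfFin hcard
    have hmem : ∀ j, ∃ t, J' t = J j := fun j => by
      have : J j ∈ Set.range J' := by
        rw [Finset.range_orderEmbOfFin]
        simp
      exact this
    choose t ht using hmem
    have htinj : Function.Injective t := fun j j' h => hJ (by rw [← ht, ← ht, h])
    let σ : Equiv.Perm (Fin k) := Equiv.ofBijective t (Finite.injective_iff_bijective.mp htinj)
    refine ⟨Equiv.Perm.sign σ, J', fun M => ?_⟩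
    have : M.submatrix J id = (M.submatrix J' id).submatrix σ id := by
      ext i j
      simp [σ, ht]
    rw [this, Matrix.det_permute]
    rfl
  · obtain ⟨i, j, hij, hne⟩ : ∃ i j, J i = J j ∧ i ≠ j := by
      simpa [Function.Injective] using hJ
    -- A repeated row makes the minor zero, so any maximal minor will do; `I` only ensures that one
    -- exists.
    refine ⟨0, I, fun M => ?_⟩
    rw [zero_mul]
    exact Matrix.det_zero_of_row_eq hne (funext fun b => by simp [hij])

/-- The scalar by which the minor of rows `J` is a multiple of a maximal minor. -/
noncomputable def rowSign (I : Fin k ↪o Fin r) (J : Fin k → Fin r) : ℂ :=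
  (exists_det_submatrix_eq I J).choose

/-- The rows of the maximal minor proportional to the minor of rows `J`. -/
noncomputable def rowSort (I : Fin k ↪o Fin r) (J : Fin k → Fin r) : Fin k ↪o Fin r :=
  (exists_det_submatrix_eq I J).choose_spec.choose

theorem det_submatrix_eq (I : Fin k ↪o Fin r) (J : Fin k → Fin r) (M : Matrix (Fin r) (Fin k) ℂ) :
    (M.submatrix J id).det = rowSign I J * maximalMinors M (rowSort I J) :=
  (exists_det_submatrix_eq I J).choose_spec.choose_spec M

/-- The matrix with identity rows in positions `I` whose maximal minors are proportional to `p`,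
if there is one. -/
noncomputable def chartMatrix (I : Fin k ↪o Fin r) (p : (Fin k ↪o Fin r) → ℂ) :
    Matrix (Fin r) (Fin k) ℂ :=
  Matrix.of fun a b =>
    rowSign I (Function.update I b a) * (p (rowSort I (Function.update I b a)) / p I)

theorem chartMatrix_smul (I : Fin k ↪o Fin r) (p : (Fin k ↪o Fin r) → ℂ) {u : ℂ} (hu : u ≠ 0) :
    chartMatrix I (u • p) = chartMatrix I p := by
  ext a b
  simp [chartMatrix, mul_div_mul_left _ _ hu]

/-- Replacing row `b` of the identity block by row `a` of `M` gives a matrix of determinant `M a b`.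
Thus each entry of a normalized matrix is itself a minor, up to the sign that sorts its rows. -/
theorem chartMatrix_maximalMinors {I : Fin k ↪o Fin r} {M : Matrix (Fin r) (Fin k) ℂ}
    (hM : M.submatrix I id = 1) : chartMatrix I (maximalMinors M) = M := by
  ext a b
  have hI : maximalMinors M I = 1 := by simp [maximalMinors, hM]
  have hup : M.submatrix (Function.update I b a) id =
      (1 : Matrix (Fin k) (Fin k) ℂ).updateRow b (M a) := by
    ext i j
    by_cases hi : i = b
    · subst hi
      simp
    · simpa [Function.update_of_ne hi, Matrix.updateRow_ne hi] using congrFun₂ hM i j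
  have hdet : ((1 : Matrix (Fin k) (Fin k) ℂ).updateRow b (M a)).det = M a b := by
    rw [← Matrix.cramer_transpose_apply, Matrix.transpose_one, Matrix.cramer_one]
    rfl
  rw [chartMatrix, Matrix.of_apply, hI, div_one, ← det_submatrix_eq, hup, hdet]

/-- In the chart where the Plücker coordinate of index `I` does not vanish, a subspace is the
column space of its chart matrix. -/
theorem chartMatrix_pluckerPoint {W : Submodule ℂ (Fin r → ℂ)} (hW : Module.finrank ℂ W = k)
    {I : Fin k ↪o Fin r} (hI : (pluckerPoint W hW).rep I ≠ 0) :
    (chartMatrix I (pluckerPoint W hW).rep).submatrix I id = 1 ∧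
      LinearMap.range (chartMatrix I (pluckerPoint W hW).rep).mulVecLin = W ∧
      ∀ J, (pluckerPoint W hW).rep J / (pluckerPoint W hW).rep I =
        maximalMinors (chartMatrix I (pluckerPoint W hW).rep) J := by
  have hB : Function.Injective (basisMatrix W hW).mulVecLin := Matrix.mulVec_injective_iff.mpr
    ((Module.finBasisOfFinrankEq ℂ W hW).linearIndependent.map' W.subtype W.ker_subtype)
  obtain ⟨u, hu, hrep⟩ := pluckerPoint_rep_eq hW (range_basisMatrix W hW)
  set B := basisMatrix W hW
  have hdet : (B.submatrix I id).det ≠ 0 := by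
    rw [hrep] at hI
    exact right_ne_zero_of_mul hI
  -- The change of basis that turns the rows `I` of `B` into the identity.
  let A : GL (Fin k) ℂ := (Matrix.GeneralLinearGroup.mkOfDetNeZero _ hdet)⁻¹
  have hMI : (B * A.val).submatrix I id = 1 := by
    change (A⁻¹).val * A.val = 1
    rw [← Units.val_mul, inv_mul_cancel, Units.val_one]
  have hA : A.val.det ≠ 0 := ((Matrix.isUnit_iff_isUnit_det _).mp A.isUnit).ne_zero
  have hchart : chartMatrix I (pluckerPoint W hW).rep = B * A.val := by
    rw [hrep, chartMatrix_smul _ _ hu, ← chartMatrix_smul _ _ hA, ← maximalMinors_mul,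
      chartMatrix_maximalMinors hMI]
  refine ⟨by rw [hchart, hMI], by rw [hchart, Matrix.range_mul_GL, range_basisMatrix], fun J => ?_⟩
  have hI1 : maximalMinors (B * A.val) I = 1 := by simp only [maximalMinors, hMI, Matrix.det_one]
  rw [maximalMinors_mul, Pi.smul_apply, smul_eq_mul] at hI1
  have hIne := right_ne_zero_of_mul (hI1.trans_ne one_ne_zero)
  rw [hchart, hrep, maximalMinors_mul]
  simp only [Pi.smul_apply, smul_eq_mul]
  rw [mul_div_mul_left _ _ hu, div_eq_iff hIne, mul_right_comm, hI1, one_mul]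

/-- The Plücker point determines the chart matrix, whose column space is the subspace. -/
theorem pluckerPoint_injective {W W' : Submodule ℂ (Fin r → ℂ)} (hW : Module.finrank ℂ W = k)
    (hW' : Module.finrank ℂ W' = k) (h : pluckerPoint W hW = pluckerPoint W' hW') : W = W' := by
  obtain ⟨I, hI⟩ := Function.ne_iff.mp (pluckerPoint W hW).rep_nonzero
  have h1 := (chartMatrix_pluckerPoint hW hI).2.1
  rw [h] at h1 hI
  rw [← h1, (chartMatrix_pluckerPoint hW' hI).2.1]

end Plucker

/-! ### Finiteness of the generators and arrows, and dimensions at the nodes. -/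

instance (g n : ℕ) : Finite (SurfaceGen g n) :=
  Finite.of_injective (β := Fin g ⊕ Fin g ⊕ Fin n)
    (fun
      | .α j => .inl j
      | .β j => .inr (.inl j)
      | .γ i => .inr (.inr i))
    (by rintro (_ | _ | _) (_ | _ | _) h <;> simp_all)

instance (g n : ℕ) (s : Fin n → ℕ) : Finite (StarArrow g s) :=
  Finite.of_injective (β := (Fin g ⊕ Fin g) ⊕ Fin n ⊕ (Σ i, Fin (s i)) ⊕ (Σ i, Fin (s i)))
    (fun
      | .a j => .inl (.inl j)
      | .b j => .inl (.inr j)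
      | .c i => .inr (.inl i)
      | .e i ℓ => .inr (.inr (.inl ⟨i, ℓ⟩))
      | .c' i ℓ => .inr (.inr (.inr ⟨i, ℓ⟩)))
    (by rintro (_ | _ | _ | _ | _) (_ | _ | _ | _ | _) h <;> simp_all)

namespace ParabolicType

variable {n r : ℕ} (T : ParabolicType n r)

theorem dim_node (i : Fin n) (ℓ : Fin (T.s i + 1)) : T.dim (.node i ℓ) = tailSum (T.d i) ℓ := by
  cases ℓ using Fin.cases with
  | zero =>
    have h : (Finset.Ici 0 : Finset (Fin (T.s i + 1))) = Finset.univ := by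
      ext j
      simp
    change r = _
    rw [tailSum, h, T.sum_eq]
  | succ ℓ => rfl

end ParabolicType

/-! ### Composites along the legs and the surface relation. -/

namespace QuiverRep

variable {g n r : ℕ} {T : ParabolicType n r}

theorem legComposite_zero (x : QuiverRep g T) (i : Fin n) :
    x.legComposite i 0 = (1 : Matrix (Fin r) (Fin r) ℂ) := rfl

theorem legComposite_succ (x : QuiverRep g T) (i : Fin n) (ℓ : Fin (T.s i)) :
    x.legComposite i ℓ.succ = x.legComposite i ℓ.castSucc * x.edge i ℓ :=
  Fin.induction_succ _ _ _

/-- The group elements at intermediate nodes cancel in the composite, leaving only those at its two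
ends. -/
theorem legComposite_smul (h : QuiverGL T) (x : QuiverRep g T) (i : Fin n)
    (ℓ : Fin (T.s i + 1)) : (h • x).legComposite i ℓ =
      h.atCenter.val * x.legComposite i ℓ * (h (.node i ℓ))⁻¹.val := by
  induction ℓ using Fin.induction with
  | zero =>
    have hone (A : GL (Fin r) ℂ) : (1 : Matrix (Fin r) (Fin r) ℂ) = A.val * 1 * A⁻¹.val := by
      rw [Matrix.mul_one, ← Units.val_mul, mul_inv_cancel, Units.val_one]
    exact hone (h .center)
  | succ ℓ ih =>
    have he : (h • x).edge i ℓ =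
        (h (.node i ℓ.castSucc)).val * x.edge i ℓ * (h (.node i ℓ.succ))⁻¹.val := rfl
    have hcancel : (h (.node i ℓ.castSucc))⁻¹.val * (h (.node i ℓ.castSucc)).val = 1 := by
      rw [← Units.val_mul, inv_mul_cancel, Units.val_one]
    rw [legComposite_succ, legComposite_succ, ih, he]
    simp only [Matrix.mul_assoc]
    rw [← Matrix.mul_assoc (h (.node i ℓ.castSucc))⁻¹.val, hcancel, Matrix.one_mul]

theorem central_smul (h : QuiverGL T) (x : QuiverRep g T) (a : SurfaceGen g n) :
    (h • x).central a = h.atCenter.val * x.central a * h.atCenter⁻¹.val := by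
  cases a <;> rfl

/-- Stacking the commuting squares along the leg. In terms of column spaces, the central loop maps
the image of each composite into itself. -/
theorem central_mul_legComposite {x : QuiverRep g T}
    (hx : ∀ i (ℓ : Fin (T.s i)),
      x.loop i ℓ.castSucc * x.edge i ℓ = x.edge i ℓ * x.loop i ℓ.succ)
    (i : Fin n) (ℓ : Fin (T.s i + 1)) :
    x.central (.γ i) * x.legComposite i ℓ = x.legComposite i ℓ * x.loop i ℓ := by
  induction ℓ using Fin.induction with
  | zero => exact (Matrix.mul_one _).trans (Matrix.one_mul _).symm
  | succ ℓ ih =>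
    rw [legComposite_succ, ← Matrix.mul_assoc, ih, Matrix.mul_assoc, hx, Matrix.mul_assoc]

/-- Links the relation in the group `GL` to the matrix equation; inverses of units agree with the
matrix inverses in `relatorValue`. -/
theorem coe_lift_surfaceRelator {x : QuiverRep g T} {f : SurfaceGen g n → GL (Fin r) ℂ}
    (hf : ∀ a, (f a).val = x.central a) :
    (FreeGroup.lift f (surfaceRelator g n)).val = x.relatorValue := by
  rw [surfaceRelator, relatorValue]
  simp only [map_mul, map_list_prod, List.map_ofFn, Function.comp_def, map_inv,
    FreeGroup.lift_apply_of, Units.val_mul, ← hf]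
  rw [← Units.coeHom_apply (List.prod _), ← Units.coeHom_apply (List.prod _),
    map_list_prod, map_list_prod, List.map_ofFn, List.map_ofFn]
  simp only [Function.comp_def, Units.coeHom_apply, Units.val_mul, Matrix.coe_units_inv]

end QuiverRep

namespace IsPRPRep

variable {g n r : ℕ} {T : ParabolicType n r} {x y : QuiverRep g T}

theorem injective_legComposite (hx : IsPRPRep x) (i : Fin n) (ℓ : Fin (T.s i + 1)) :
    Function.Injective (x.legComposite i ℓ).mulVecLin := by
  induction ℓ using Fin.induction with
  | zero => exact (Matrix.mulVecLin_one (R := ℂ) (n := Fin r)) ▸ Function.injective_id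
  | succ ℓ ih =>
    rw [QuiverRep.legComposite_succ]
    exact Matrix.injective_mul ih (hx.injective (.e i ℓ))

theorem det_central_ne_zero (hx : IsPRPRep x) (a : SurfaceGen g n) : (x.central a).det ≠ 0 := by
  refine Matrix.injective_iff_det_ne_zero.mp ?_
  cases a with
  | α j => exact hx.injective (.a j)
  | β j => exact hx.injective (.b j)
  | γ i => exact hx.injective (.c i)

/-- A representation is determined by its central matrices and the composites along the legs. -/
theorem ext (hx : IsPRPRep x) (hy : IsPRPRep y) (hc : x.central = y.central)
    (hL : ∀ i ℓ, x.legComposite i ℓ = y.legComposite i ℓ) : x = y := by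
  funext a
  cases a with
  | a j => exact congrFun hc (.α j)
  | b j => exact congrFun hc (.β j)
  | c i => exact congrFun hc (.γ i)
  | e i ℓ =>
    refine Matrix.mul_left_cancel_of_injective (hx.injective_legComposite i ℓ.castSucc) ?_
    have h := hL i ℓ.succ
    rw [QuiverRep.legComposite_succ, QuiverRep.legComposite_succ, ← hL i ℓ.castSucc] at h
    exact h
  | c' i ℓ =>
    refine Matrix.mul_left_cancel_of_injective (hx.injective_legComposite i ℓ.succ) ?_
    have h := QuiverRep.central_mul_legComposite hx.commute i ℓ.succ
    rw [hc, hL i ℓ.succ, QuiverRep.central_mul_legComposite hy.commute i ℓ.succ, ← hL i ℓ.succ] at h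
    exact h.symm

end IsPRPRep

/-! ## The map from representations of the quiver to parabolic pairs -/

namespace PRP

variable {g n r : ℕ} {T : ParabolicType n r}

theorem ext_of_gen {p p' : PRP g T}
    (hρ : ∀ a, (p.ρ (SurfaceGroup.gen a) : Matrix (Fin r) (Fin r) ℂ) = p'.ρ (SurfaceGroup.gen a))
    (hflag : ∀ i ℓ, (p.flag i).sub ℓ = (p'.flag i).sub ℓ) : p = p' := by
  refine PRP.ext (PresentedGroup.ext fun a => Units.ext (hρ a)) (funext fun i => ?_)
  exact TypedFlag.ext (funext fun ℓ => hflag i ℓ)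

theorem smul_flag_sub (A : GL (Fin r) ℂ) (p : PRP g T) (i : Fin n) (ℓ : Fin (T.s i + 1)) :
    ((A • p).flag i).sub ℓ = ((p.flag i).sub ℓ).map (Matrix.mulVecLin A.val) := rfl

theorem smul_rho (A : GL (Fin r) ℂ) (p : PRP g T) (a : SurfaceGroup g n) :
    (A • p).ρ a = A * p.ρ a * A⁻¹ := rfl

end PRP

namespace PRPRep

variable {g n r : ℕ} {T : ParabolicType n r}

/-- The matrices at the centre as elements of `GL_r`. -/
noncomputable def centralGL (x : PRPRep g T) (a : SurfaceGen g n) : GL (Fin r) ℂ :=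
  Matrix.GeneralLinearGroup.mkOfDetNeZero _ (x.2.det_central_ne_zero a)

theorem coe_centralGL (x : PRPRep g T) (a : SurfaceGen g n) :
    (x.centralGL a : Matrix (Fin r) (Fin r) ℂ) = x.1.central a := rfl

theorem lift_centralGL_eq_one (x : PRPRep g T) :
    ∀ w ∈ ({surfaceRelator g n} : Set (FreeGroup (SurfaceGen g n))),
      FreeGroup.lift x.centralGL w = 1 := by
  rintro _ rfl
  exact Units.ext ((QuiverRep.coe_lift_surfaceRelator fun _ => rfl).trans x.2.relation)

/-- The parabolic representation pair defined by a representation of the quiver. -/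
noncomputable def toPRP (x : PRPRep g T) : PRP g T where
  ρ := PresentedGroup.toGroup x.lift_centralGL_eq_one
  flag i :=
    { sub := fun ℓ => LinearMap.range (Matrix.mulVecLin (x.1.legComposite i ℓ))
      sub_zero := by
        rw [QuiverRep.legComposite_zero]
        exact (congrArg LinearMap.range Matrix.mulVecLin_one).trans LinearMap.range_id
      antitone := by
        refine Fin.antitone_iff_succ_le.mpr fun ℓ => ?_
        rw [QuiverRep.legComposite_succ, Matrix.mulVecLin_mul]
        exact LinearMap.range_comp_le_range _ _
      finrank_sub := fun ℓ => by
        rw [LinearMap.finrank_range_of_inj (x.2.injective_legComposite i ℓ), Module.finrank_fin_fun,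
          T.dim_node] }
  mem_parabolic i := by
    refine MulAction.mem_stabilizer_iff.mpr (TypedFlag.ext (funext fun ℓ => ?_))
    change Submodule.map (Matrix.mulVecLin (PresentedGroup.toGroup _ (PresentedGroup.of _) :
      GL (Fin r) ℂ).val) _ = _
    -- The loop at the node is square and injective, hence invertible, so multiplying the composite
    -- by it on the right leaves the column space unchanged.
    have hloop : (x.1.loop i ℓ).det ≠ 0 := by
      refine Matrix.injective_iff_det_ne_zero.mp ?_
      cases ℓ using Fin.cases with
      | zero => exact x.2.injective (.c i)
      | succ ℓ => exact x.2.injective (.c' i ℓ)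
    rw [PresentedGroup.toGroup.of, coe_centralGL, ← LinearMap.range_comp, ← Matrix.mulVecLin_mul,
      QuiverRep.central_mul_legComposite x.2.commute]
    exact Matrix.range_mul_GL _ (Matrix.GeneralLinearGroup.mkOfDetNeZero _ hloop)

theorem toPRP_rho (x : PRPRep g T) (a : SurfaceGen g n) :
    ((x.toPRP.ρ (SurfaceGroup.gen a) : GL (Fin r) ℂ) : Matrix (Fin r) (Fin r) ℂ) =
      x.1.central a :=
  congrArg Units.val (PresentedGroup.toGroup.of x.lift_centralGL_eq_one)

theorem toPRP_sub (x : PRPRep g T) (i : Fin n) (ℓ : Fin (T.s i + 1)) :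
    (x.toPRP.flag i).sub ℓ = LinearMap.range (Matrix.mulVecLin (x.1.legComposite i ℓ)) := rfl

theorem toPRP_smul (h : QuiverGL T) (x : PRPRep g T) : (h • x).toPRP = h.atCenter • x.toPRP := by
  refine PRP.ext_of_gen (fun a => ?_) fun i ℓ => ?_
  · rw [toPRP_rho, PRP.smul_rho, Units.val_mul, Units.val_mul, toPRP_rho]
    exact QuiverRep.central_smul h x.1 a
  · rw [PRP.smul_flag_sub, toPRP_sub, toPRP_sub, ← LinearMap.range_comp, ← Matrix.mulVecLin_mul]
    change LinearMap.range ((h • x.1).legComposite i ℓ).mulVecLin = _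
    rw [QuiverRep.legComposite_smul, Matrix.range_mul_GL]

/-- Equal flags give, at each node, a change of basis between the two composites. These assemble
into a group element carrying one set of composites to the other, which suffices by `IsPRPRep.ext`.
-/
theorem exists_smul_eq_of_toPRP_eq {x y : PRPRep g T} (hxy : x.toPRP = y.toPRP) :
    ∃ h : QuiverGL.legSubgroup T, h • x = y := by
  have hc : x.1.central = y.1.central := funext fun a => by
    rw [← toPRP_rho, hxy, toPRP_rho]
  have hL : ∀ i ℓ, ∃ A : GL (Fin (T.dim (.node i ℓ))) ℂ,
      y.1.legComposite i ℓ = x.1.legComposite i ℓ * A.val := fun i ℓ =>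
    Matrix.exists_GL_of_range_eq (y.2.injective_legComposite i ℓ) (by
      rw [← toPRP_sub, ← toPRP_sub, hxy])
  choose A hA using hL
  -- The inverse appears because `h` acts on composites through `h⁻¹` on the right. At the centre
  -- both composites are the identity, so no change of basis is needed.
  let h : QuiverGL T
    | .center => 1
    | .leg i ℓ => (A i ℓ.succ)⁻¹
  refine ⟨⟨h, rfl⟩, Subtype.ext ((x.2.smul h).ext y.2 ?_ fun i ℓ => ?_)⟩
  · funext a
    rw [QuiverRep.central_smul, ← hc]
    change (1 : GL (Fin r) ℂ).val * _ * (1 : GL (Fin r) ℂ)⁻¹.val = _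
    simp
  · have hcenter : h.atCenter = 1 := rfl
    rw [QuiverRep.legComposite_smul, hcenter, Units.val_one, Matrix.one_mul]
    cases ℓ using Fin.cases with
    | zero =>
      have hone : (1 : Matrix (Fin r) (Fin r) ℂ) * (1 : GL (Fin r) ℂ)⁻¹.val = 1 := by simp
      exact hone
    | succ ℓ =>
      have hleg : h (.node i ℓ.succ) = (A i ℓ.succ)⁻¹ := rfl
      rw [hA, hleg, inv_inv]

end PRPRep

open Coordinates

/-! ## Regularity of the constructions on representations of the quiver -/

section Fractions

variable {g n r : ℕ} {T : ParabolicType n r} {X : Type} {c : Coordinates X} {W : Set X}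
  {x : X → QuiverRep g T}

theorem Coordinates.IsFractionMatrix.maximalMinors {k : ℕ} {M : X → Matrix (Fin r) (Fin k) ℂ}
    (hM : c.IsFractionMatrix W M) (I : Fin k ↪o Fin r) :
    (fun q => maximalMinors (M q) I) ∈ c.fractions W :=
  (hM.submatrix I id).det

theorem Coordinates.IsFractionMatrix.central (hx : ∀ a, c.IsFractionMatrix W fun q => x q a)
    (a : SurfaceGen g n) : c.IsFractionMatrix W fun q => (x q).central a := by
  cases a with
  | α j => exact hx (.a j)
  | β j => exact hx (.b j)
  | γ i => exact hx (.c i)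

theorem Coordinates.IsFractionMatrix.loop (hx : ∀ a, c.IsFractionMatrix W fun q => x q a)
    (i : Fin n) (ℓ : Fin (T.s i + 1)) : c.IsFractionMatrix W fun q => (x q).loop i ℓ := by
  cases ℓ using Fin.cases with
  | zero => exact hx (.c i)
  | succ ℓ => exact hx (.c' i ℓ)

theorem Coordinates.IsFractionMatrix.edge (hx : ∀ a, c.IsFractionMatrix W fun q => x q a)
    (i : Fin n) (ℓ : Fin (T.s i)) : c.IsFractionMatrix W fun q => (x q).edge i ℓ :=
  hx (.e i ℓ)

theorem Coordinates.IsFractionMatrix.legComposite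
    (hx : ∀ a, c.IsFractionMatrix W fun q => x q a) (i : Fin n) (ℓ : Fin (T.s i + 1)) :
    c.IsFractionMatrix W fun q => (x q).legComposite i ℓ := by
  induction ℓ using Fin.induction with
  | zero => exact IsFractionMatrix.const (1 : Matrix (Fin r) (Fin r) ℂ)
  | succ ℓ ih =>
    simp only [QuiverRep.legComposite_succ]
    exact ih.mul (IsFractionMatrix.edge hx i ℓ)

theorem Coordinates.IsFractionMatrix.relatorValue
    (hx : ∀ a, c.IsFractionMatrix W fun q => x q a)
    (h0 : ∀ q ∈ W, ∀ a, ((x q).central a).det ≠ 0) :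
    c.IsFractionMatrix W fun q => (x q).relatorValue := by
  have hc := IsFractionMatrix.central hx
  have hinv (a : SurfaceGen g n) := (hc a).inv fun q hq => h0 q hq a
  exact (IsFractionMatrix.list_prod fun j =>
      (((hc (.α j)).mul (hc (.β j))).mul (hinv (.α j))).mul (hinv (.β j))).mul
    (IsFractionMatrix.list_prod fun i => hc (.γ i))

theorem Coordinates.isClosedOn_commute (hx : ∀ a, c.IsFractionMatrix W fun q => x q a) :
    c.IsClosedOn W fun q => ∀ i (ℓ : Fin (T.s i)),
      (x q).loop i ℓ.castSucc * (x q).edge i ℓ = (x q).edge i ℓ * (x q).loop i ℓ.succ :=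
  IsClosedOn.forall_mem fun i => IsClosedOn.forall_mem fun ℓ =>
    ((IsFractionMatrix.loop hx i ℓ.castSucc).mul (IsFractionMatrix.edge hx i ℓ)).isClosedOn_eq
      ((IsFractionMatrix.edge hx i ℓ).mul (IsFractionMatrix.loop hx i ℓ.succ))

theorem Coordinates.isClosedOn_relation (hx : ∀ a, c.IsFractionMatrix W fun q => x q a)
    (h0 : ∀ q ∈ W, ∀ a, ((x q).central a).det ≠ 0) :
    c.IsClosedOn W fun q => (x q).relatorValue = 1 :=
  (IsFractionMatrix.relatorValue hx h0).isClosedOn_eq (IsFractionMatrix.const 1)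

end Fractions

namespace PRPRep

variable {g n r : ℕ} {T : ParabolicType n r}

theorem isFractionMatrix (W : Set (PRPRep g T)) (a : StarArrow g T.s) :
    (coordinates g T).IsFractionMatrix W fun x => x.1 a :=
  fun i j => aff_mem_fractions (coordinates g T) W ⟨a, i, j⟩

theorem hasFractionLift_toPRP :
    HasFractionLift (coordinates g T) (PRP.coordinates g T) Set.univ toPRP := by
  refine ⟨Sum.elim (fun e x => x.1.central e.1 e.2.1 e.2.2)
    fun kj x => maximalMinors (x.1.legComposite kj.1.1 kj.1.2.succ) kj.2, ?_, fun x _ => ⟨?_, ?_⟩⟩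
  · rintro (⟨a, i, j⟩ | ⟨⟨i, ℓ⟩, I⟩)
    · exact IsFractionMatrix.central (isFractionMatrix Set.univ) a i j
    · have h : (coordinates g T).IsFractionMatrix (n := Fin (tailSum (T.d i) ℓ.succ)) Set.univ
          fun x => x.1.legComposite i ℓ.succ :=
        IsFractionMatrix.legComposite (isFractionMatrix Set.univ) i ℓ.succ
      exact h.maximalMinors I
  · rintro ⟨a, i, j⟩
    exact congrFun₂ (toPRP_rho x a) i j
  · rintro ⟨i, ℓ⟩
    obtain ⟨u, hu, h⟩ := pluckerPoint_rep_eq ((x.toPRP.flag i).finrank_sub ℓ.succ)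
      (toPRP_sub x i ℓ.succ).symm
    exact ⟨u, hu, fun I => congrFun h I⟩

/-- The point of the affine space of representations with given coordinates. -/
def ofAmbient (q : Ambient (coordinates g T).ι (coordinates g T).K (coordinates g T).J) :
    QuiverRep g T :=
  fun a => Matrix.of fun i j => q.aff ⟨a, i, j⟩

theorem mem_range_toAmbient_iff
    (q : Ambient (coordinates g T).ι (coordinates g T).K (coordinates g T).J) :
    q ∈ Set.range (coordinates g T).toAmbient ↔ IsPRPRep (ofAmbient q) := by
  constructor
  · rintro ⟨x, rfl⟩
    exact x.2
  · intro h
    refine ⟨⟨_, h⟩, ?_⟩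
    obtain ⟨aff, proj⟩ := q
    change Ambient.mk _ _ = Ambient.mk _ _
    congr
    funext k
    exact Empty.elim k

/-- Near a given representation, fix a nonvanishing maximal minor for every arrow. Where these
minors stay nonzero all arrows are injective and the central determinants do not vanish, so the
inverses in the relator are regular and the remaining conditions are closed. -/
theorem isVariety : (coordinates g T).IsVariety := by
  refine ⟨?_, ?_, fun k => Empty.elim k, fun x y hxy => Subtype.ext (funext fun a => ?_), ?_⟩
  · change Finite (Σ a : StarArrow g T.s, Fin (T.dim a.target) × Fin (T.dim a.source))
    infer_instance
  · change Finite Empty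
    infer_instance
  · ext i j
    exact congrFun (congrArg Ambient.aff hxy) ⟨a, i, j⟩
  refine Ambient.isLocallyClosed_of_isClosedOn fun p hp => ?_
  choose I hI using fun a =>
    exists_maximalMinors_ne_zero (((mem_range_toAmbient_iff p).mp hp).injective a)
  let cA := Ambient.selfCoordinates (coordinates g T).ι (coordinates g T).K (coordinates g T).J
  have hfrac (W) (a : StarArrow g T.s) : cA.IsFractionMatrix W fun q => ofAmbient q a :=
    fun i j => aff_mem_fractions cA W ⟨a, i, j⟩
  let W : Set (Ambient (coordinates g T).ι (coordinates g T).K (coordinates g T).J) :=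
    ⋂ a, {q ∈ Set.univ | maximalMinors (ofAmbient q a) (I a) ≠ 0}
  have hinj (q) (hq : q ∈ W) (a) : Function.Injective (ofAmbient q a).mulVecLin :=
    injective_of_det_submatrix_ne_zero (Set.mem_iInter.mp hq a).2
  have hdet : ∀ q ∈ W, ∀ a, ((ofAmbient q).central a).det ≠ 0 := fun q hq a => by
    refine Matrix.injective_iff_det_ne_zero.mp ?_
    cases a with
    | α j => exact hinj q hq (.a j)
    | β j => exact hinj q hq (.b j)
    | γ i => exact hinj q hq (.c i)
  refine ⟨W, ?_, Set.mem_iInter.mpr fun a => ⟨trivial, hI a⟩,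
    ((isClosedOn_commute (hfrac W)).and (isClosedOn_relation (hfrac W) hdet)).congr
      fun q hq => ?_⟩
  · rw [← Ambient.topology_selfCoordinates]
    let _ := cA.topology
    exact isOpen_iInter_of_finite fun a =>
      isOpen_ne_zero_of_mem_fractions isOpen_univ ((hfrac _ a).maximalMinors (I a))
  · rw [mem_range_toAmbient_iff]
    exact ⟨fun h => ⟨h.commute, h.relation⟩, fun h => ⟨hinj q hq, h.1, h.2⟩⟩

end PRPRep

/-! ## Charts of the variety of parabolic pairs -/

namespace PRP

/-- The ambient variety of the variety of parabolic pairs. -/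
abbrev AmbientSpace (g : ℕ) {n r : ℕ} (T : ParabolicType n r) : Type :=
  Ambient (coordinates g T).ι (coordinates g T).K (coordinates g T).J

/-- A choice of one Plücker coordinate for each proper subspace in the flags. -/
abbrev Chart {n r : ℕ} (T : ParabolicType n r) : Type :=
  ∀ k : Σ i, Fin (T.s i), Fin (tailSum (T.d k.1) k.2.succ) ↪o Fin r

variable {g n r : ℕ} {T : ParabolicType n r}

theorem coordinates_injective : Function.Injective (coordinates g T).toAmbient := by
  intro p p' h
  refine ext_of_gen (fun a => ?_) fun i ℓ => ?_
  · ext j j'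
    exact congrFun (congrArg Ambient.aff h) (a, j, j')
  · cases ℓ using Fin.cases with
    | zero => rw [TypedFlag.sub_zero, TypedFlag.sub_zero]
    | succ ℓ => exact pluckerPoint_injective _ _ (congrFun (congrArg Ambient.proj h) ⟨i, ℓ⟩)

/-- The matrices at the centre with given coordinates. -/
def centralMatrix (q : AmbientSpace g T) (a : SurfaceGen g n) : Matrix (Fin r) (Fin r) ℂ :=
  Matrix.of fun i j => q.aff (a, i, j)

namespace Chart

variable (I : Chart T) (q : AmbientSpace g T)

/-- The rows that are normalized to the identity matrix at each node. -/
def rows (i : Fin n) : ∀ ℓ : Fin (T.s i + 1), Fin (T.dim (.node i ℓ)) → Fin r :=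
  Fin.cases (id : Fin r → Fin r) fun ℓ => I ⟨i, ℓ⟩

/-- The matrices with normalized rows whose column spaces are the members of the flags. -/
noncomputable def columns (i : Fin n) :
    ∀ ℓ : Fin (T.s i + 1), Matrix (Fin r) (Fin (T.dim (.node i ℓ))) ℂ :=
  Fin.cases (1 : Matrix (Fin r) (Fin r) ℂ) fun ℓ => chartMatrix (I ⟨i, ℓ⟩) (q.proj ⟨i, ℓ⟩).rep

/-- The representation of the quiver that parametrizes each member of the flags by the normalized
basis. -/
noncomputable def quiverRep : QuiverRep g T
  | .a j => centralMatrix q (.α j)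
  | .b j => centralMatrix q (.β j)
  | .c i => centralMatrix q (.γ i)
  -- The basis matrix at the node nearer the centre has identity rows in the positions `rows`, so
  -- coefficients in that basis are read off from those rows. The loops below are obtained in the
  -- same way.
  | .e i ℓ => (I.columns q i ℓ.succ).submatrix (I.rows i ℓ.castSucc) id
  | .c' i ℓ => (centralMatrix q (.γ i) * I.columns q i ℓ.succ).submatrix (I.rows i ℓ.succ) id

/-- The open subset of the ambient variety on which the chart is defined. -/
def domain : Set (AmbientSpace g T) :=
  {q | (∀ k, (q.proj k).rep (I k) ≠ 0) ∧ ∀ a, (centralMatrix q a).det ≠ 0}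

/-- The equations of the variety of parabolic pairs in a chart. -/
structure Equations : Prop where
  commute : ∀ i (ℓ : Fin (T.s i)), (I.quiverRep q).loop i ℓ.castSucc * (I.quiverRep q).edge i ℓ =
    (I.quiverRep q).edge i ℓ * (I.quiverRep q).loop i ℓ.succ
  relation : (I.quiverRep q).relatorValue = 1
  legComposite : ∀ i (ℓ : Fin (T.s i)),
    (I.quiverRep q).legComposite i ℓ.succ = I.columns q i ℓ.succ
  minors : ∀ (i) (ℓ : Fin (T.s i)) (J : Fin (tailSum (T.d i) ℓ.succ) ↪o Fin r),
    (q.proj ⟨i, ℓ⟩).rep J / (q.proj ⟨i, ℓ⟩).rep (I ⟨i, ℓ⟩) =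
      maximalMinors (I.columns q i ℓ.succ) J

theorem central_quiverRep (a : SurfaceGen g n) : (I.quiverRep q).central a = centralMatrix q a := by
  cases a <;> rfl

/-- The coordinates on the ambient variety. -/
abbrev ambientCoordinates (g : ℕ) {n r : ℕ} (T : ParabolicType n r) :
    Coordinates (AmbientSpace g T) :=
  Ambient.selfCoordinates (coordinates g T).ι (coordinates g T).K (coordinates g T).J

theorem isFractionMatrix_centralMatrix (W : Set (AmbientSpace g T)) (a : SurfaceGen g n) :
    (ambientCoordinates g T).IsFractionMatrix W fun q => centralMatrix q a :=
  fun i j => aff_mem_fractions (ambientCoordinates g T) W (a, i, j)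

theorem isFractionMatrix_columns (i : Fin n) (ℓ : Fin (T.s i + 1)) :
    (ambientCoordinates g T).IsFractionMatrix I.domain fun q => I.columns q i ℓ := by
  cases ℓ using Fin.cases with
  | zero => exact IsFractionMatrix.const (1 : Matrix (Fin r) (Fin r) ℂ)
  | succ ℓ =>
    exact fun a b => mul_mem ((fractions _ _).algebraMap_mem _)
      (proj_div_mem_fractions (c := ambientCoordinates g T) (k := ⟨i, ℓ⟩) (fun q hq => hq.1 _) _)

theorem isFractionMatrix_quiverRep (a : StarArrow g T.s) :
    (ambientCoordinates g T).IsFractionMatrix I.domain fun q => I.quiverRep q a := by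
  cases a with
  | a j => exact isFractionMatrix_centralMatrix _ _
  | b j => exact isFractionMatrix_centralMatrix _ _
  | c i => exact isFractionMatrix_centralMatrix _ _
  | e i ℓ => exact (I.isFractionMatrix_columns i ℓ.succ).submatrix _ id
  | c' i ℓ =>
    exact ((isFractionMatrix_centralMatrix _ _).mul
      (I.isFractionMatrix_columns i ℓ.succ)).submatrix _ id

theorem isOpen_domain : IsOpen (I.domain : Set (AmbientSpace g T)) := by
  rw [← Ambient.topology_selfCoordinates]
  let _ := (ambientCoordinates g T).topology
  have h1 : IsOpen (⋂ k, {q : AmbientSpace g T | (q.proj k).rep (I k) ≠ 0}) := by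
    have : Finite (coordinates g T).K := inferInstanceAs (Finite (Σ i, Fin (T.s i)))
    exact isOpen_iInter_of_finite fun k => (ambientCoordinates g T).isOpen_proj_ne_zero k (I k)
  have h2 : IsOpen (⋂ a, {q : AmbientSpace g T | q ∈ Set.univ ∧ (centralMatrix q a).det ≠ 0}) :=
    isOpen_iInter_of_finite fun a => isOpen_ne_zero_of_mem_fractions
      (c := ambientCoordinates g T) isOpen_univ (isFractionMatrix_centralMatrix _ a).det
  convert h1.inter h2 using 1
  ext q
  simp [domain]

theorem isClosedOn_equations :
    (ambientCoordinates g T).IsClosedOn I.domain I.Equations := by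
  have h1 := isClosedOn_commute (g := g) I.isFractionMatrix_quiverRep
  have h2 := isClosedOn_relation (g := g) I.isFractionMatrix_quiverRep fun q hq a => by
    rw [central_quiverRep]
    exact hq.2 a
  have h3 : (ambientCoordinates g T).IsClosedOn I.domain fun q => ∀ i (ℓ : Fin (T.s i)),
      (I.quiverRep q).legComposite i ℓ.succ = I.columns q i ℓ.succ :=
    IsClosedOn.forall_mem fun i => IsClosedOn.forall_mem fun ℓ =>
      (IsFractionMatrix.legComposite I.isFractionMatrix_quiverRep i ℓ.succ).isClosedOn_eq
        (I.isFractionMatrix_columns i ℓ.succ)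
  have h4 : (ambientCoordinates g T).IsClosedOn I.domain fun q => ∀ (i) (ℓ : Fin (T.s i))
      (J : Fin (tailSum (T.d i) ℓ.succ) ↪o Fin r),
      (q.proj ⟨i, ℓ⟩).rep J / (q.proj ⟨i, ℓ⟩).rep (I ⟨i, ℓ⟩) =
        maximalMinors (I.columns q i ℓ.succ) J :=
    IsClosedOn.forall_mem fun i => IsClosedOn.forall_mem fun ℓ => IsClosedOn.forall_mem fun J =>
      IsClosedOn.eq_of_mem_fractions
        (proj_div_mem_fractions (c := ambientCoordinates g T) (k := ⟨i, ℓ⟩) (fun q hq => hq.1 _) J)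
        (IsFractionMatrix.maximalMinors (k := tailSum (T.d i) ℓ.succ)
          (I.isFractionMatrix_columns i ℓ.succ) J)
  exact (((h1.and h2).and h3).and h4).congr fun q _ =>
    ⟨fun h => ⟨⟨⟨h.commute, h.relation⟩, h.legComposite⟩, h.minors⟩,
      fun h => ⟨h.1.1.1, h.1.1.2, h.1.2, h.2⟩⟩

variable {I q}

/-- The composites are the normalized column matrices, hence injective. An edge is a right factor of
a composite; a loop on a leg is a right factor of the invertible central loop times a composite. -/
theorem Equations.isPRPRep (h : I.Equations q) (hq : q ∈ I.domain) : IsPRPRep (I.quiverRep q) := by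
  have hL (i) (ℓ : Fin (T.s i)) :
      Function.Injective ((I.quiverRep q).legComposite i ℓ.succ).mulVecLin := by
    rw [h.legComposite]
    refine injective_of_det_submatrix_ne_zero (I := I ⟨i, ℓ⟩) ?_
    -- Taking `J` to be the chart index in `minors` shows that the normalized minor equals `1`.
    exact ((h.minors i ℓ (I ⟨i, ℓ⟩)).symm.trans (div_self (hq.1 ⟨i, ℓ⟩))).trans_ne one_ne_zero
  refine ⟨fun a => ?_, h.commute, h.relation⟩
  cases a with
  | a j => exact Matrix.injective_iff_det_ne_zero.mpr (hq.2 (.α j))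
  | b j => exact Matrix.injective_iff_det_ne_zero.mpr (hq.2 (.β j))
  | c i => exact Matrix.injective_iff_det_ne_zero.mpr (hq.2 (.γ i))
  | e i ℓ =>
    have := hL i ℓ
    rw [QuiverRep.legComposite_succ] at this
    exact Matrix.injective_of_mul this
  | c' i ℓ =>
    have hcomm := QuiverRep.central_mul_legComposite h.commute i ℓ.succ
    refine Matrix.injective_of_mul (M := (I.quiverRep q).legComposite i ℓ.succ)
      (N := (I.quiverRep q).loop i ℓ.succ) ?_
    rw [← hcomm]
    exact Matrix.injective_mul (Matrix.injective_iff_det_ne_zero.mpr (hq.2 (.γ i))) (hL i ℓ)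

/-- Sufficiency of the equations: the constructed representation yields a pair with coordinates `q`.
The equations `minors` force every Plücker coordinate of `q`, not only those entering the chart
matrix, to be the right one. -/
theorem Equations.toAmbient_toPRP (h : I.Equations q) (hq : q ∈ I.domain) :
    (coordinates g T).toAmbient (PRPRep.toPRP ⟨_, h.isPRPRep hq⟩) = q := by
  obtain ⟨x, hx⟩ : ∃ x : PRPRep g T, x = ⟨_, h.isPRPRep hq⟩ := ⟨_, rfl⟩
  have hx1 : x.1 = I.quiverRep q := congrArg Subtype.val hx
  rw [← hx]
  have haff : ((coordinates g T).toAmbient x.toPRP).aff = q.aff := by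
    funext ⟨a, i, j⟩
    have := congrFun₂ (x.toPRP_rho a) i j
    rwa [hx1, central_quiverRep] at this
  have hproj : ((coordinates g T).toAmbient x.toPRP).proj = q.proj := by
    funext ⟨i, ℓ⟩
    obtain ⟨u, -, hu⟩ := pluckerPoint_rep_eq ((x.toPRP.flag i).finrank_sub ℓ.succ)
      (x.toPRP_sub i ℓ.succ).symm
    refine Projectivization.eq_of_rep_eq_smul
      (u := u / (q.proj ⟨i, ℓ⟩).rep (I ⟨i, ℓ⟩)) (hu.trans (funext fun J => ?_))
    rw [hx1, h.legComposite]
    refine (congrArg (u * ·) (h.minors i ℓ J).symm).trans ?_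
    exact (mul_div_assoc _ _ _).symm.trans (div_mul_eq_mul_div _ _ _).symm
  cases q
  exact congrArg₂ Ambient.mk haff hproj

variable {p : PRP g T}

theorem columns_toAmbient (hp : (coordinates g T).toAmbient p ∈ I.domain) (i : Fin n)
    (ℓ : Fin (T.s i + 1)) :
    (I.columns ((coordinates g T).toAmbient p) i ℓ).submatrix (I.rows i ℓ) id = 1 ∧
      LinearMap.range (I.columns ((coordinates g T).toAmbient p) i ℓ).mulVecLin =
        (p.flag i).sub ℓ := by
  cases ℓ using Fin.cases with
  | zero =>
    refine ⟨Matrix.submatrix_id_id (1 : Matrix (Fin r) (Fin r) ℂ), ?_⟩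
    rw [TypedFlag.sub_zero]
    exact (congrArg LinearMap.range Matrix.mulVecLin_one).trans LinearMap.range_id
  | succ ℓ =>
    have h := chartMatrix_pluckerPoint ((p.flag i).finrank_sub ℓ.succ) (hp.1 ⟨i, ℓ⟩)
    exact ⟨h.1, h.2.1⟩

/-- Write `M` as the normalized basis matrix times `A`; restricting to the normalized rows, where
the basis matrix is the identity, shows what `A` is. -/
theorem eq_columns_mul_submatrix {m : Type} [Fintype m]
    (hp : (coordinates g T).toAmbient p ∈ I.domain) {i : Fin n}
    {ℓ : Fin (T.s i + 1)} {M : Matrix (Fin r) m ℂ}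
    (hM : LinearMap.range M.mulVecLin ≤ (p.flag i).sub ℓ) :
    M = I.columns ((coordinates g T).toAmbient p) i ℓ * M.submatrix (I.rows i ℓ) id := by
  obtain ⟨h1, h2⟩ := columns_toAmbient hp i ℓ
  obtain ⟨A, hA⟩ := Matrix.exists_eq_mul_of_range_le (hM.trans h2.ge)
  have : M.submatrix (I.rows i ℓ) id = A := by
    rw [hA, ← Matrix.submatrix_mul_equiv _ _ _ (Equiv.refl _)]
    change (I.columns ((coordinates g T).toAmbient p) i ℓ).submatrix (I.rows i ℓ) id * A = A
    rw [h1, Matrix.one_mul]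
  rw [this, hA]

/-- Necessity of the equations. Nestedness of the flag makes the edges express each normalized basis
in the preceding one, and invariance under the monodromy does the same for the loops. -/
theorem equations_toAmbient (hp : (coordinates g T).toAmbient p ∈ I.domain) :
    I.Equations ((coordinates g T).toAmbient p) := by
  set q := (coordinates g T).toAmbient p with hq
  set x := I.quiverRep q with hx
  have hcentral (a) : x.central a = (p.ρ (SurfaceGroup.gen a)).val := central_quiverRep I q a
  have hedge (i) (ℓ : Fin (T.s i)) : I.columns q i ℓ.succ = I.columns q i ℓ.castSucc * x.edge i ℓ :=
    eq_columns_mul_submatrix hp (by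
      rw [(columns_toAmbient hp i ℓ.succ).2]
      exact (p.flag i).antitone ℓ.castSucc_lt_succ.le)
  have hleg (i) (ℓ : Fin (T.s i + 1)) : x.legComposite i ℓ = I.columns q i ℓ := by
    induction ℓ using Fin.induction with
    | zero => rfl
    | succ ℓ ih => rw [QuiverRep.legComposite_succ, ih, hedge]
  have hloop (i) (ℓ : Fin (T.s i + 1)) :
      x.central (.γ i) * I.columns q i ℓ = I.columns q i ℓ * x.loop i ℓ := by
    cases ℓ using Fin.cases with
    | zero => exact (Matrix.mul_one _).trans (Matrix.one_mul _).symm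
    | succ ℓ =>
      refine eq_columns_mul_submatrix hp ?_
      rw [Matrix.mulVecLin_mul, LinearMap.range_comp, (columns_toAmbient hp i ℓ.succ).2, hcentral]
      have h : p.ρ (SurfaceGroup.gen (.γ i)) • p.flag i = p.flag i := p.mem_parabolic i
      exact (congrArg (fun F => TypedFlag.sub F ℓ.succ) h).le
  refine ⟨fun i ℓ => ?_, ?_, fun i ℓ => hleg i ℓ.succ, fun i ℓ J => ?_⟩
  · have hinj : Function.Injective (I.columns q i ℓ.castSucc).mulVecLin :=
      injective_of_det_submatrix_ne_zero (I := I.rows i ℓ.castSucc) (by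
        rw [(columns_toAmbient hp i ℓ.castSucc).1, Matrix.det_one]
        exact one_ne_zero)
    -- After multiplication by the injective basis matrix, both sides become the central loop
    -- applied to the next basis matrix.
    refine Matrix.mul_left_cancel_of_injective hinj ?_
    rw [← Matrix.mul_assoc, ← hloop, Matrix.mul_assoc, ← hedge, hloop, hedge, Matrix.mul_assoc]
  · rw [← QuiverRep.coe_lift_surfaceRelator (f := fun a => p.ρ (SurfaceGroup.gen a))
      fun a => (hcentral a).symm]
    -- The evaluation of words factors through the surface group, where the relator is trivial.
    have hlift : FreeGroup.lift (fun a => p.ρ (SurfaceGroup.gen a)) =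
        p.ρ.comp (PresentedGroup.mk {surfaceRelator g n}) := by
      ext1 a
      simp [SurfaceGroup.gen, PresentedGroup.of]
    rw [hlift, MonoidHom.comp_apply, PresentedGroup.one_of_mem (Set.mem_singleton _), map_one,
      Units.val_one]
  · exact (chartMatrix_pluckerPoint ((p.flag i).finrank_sub ℓ.succ) (hp.1 ⟨i, ℓ⟩)).2.2 J

theorem exists_mem_domain (p : PRP g T) :
    ∃ I : Chart T, (coordinates g T).toAmbient p ∈ I.domain := by
  choose I hI using fun k : Σ i, Fin (T.s i) =>
    Function.ne_iff.mp (((coordinates g T).toAmbient p).proj k).rep_nonzero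
  exact ⟨I, hI, fun a =>
    ((Matrix.isUnit_iff_isUnit_det _).mp (p.ρ (SurfaceGroup.gen a)).isUnit).ne_zero⟩

end Chart

/-- The chart domains are open and cover the image, and on each of them the image is exactly the
locus of `Chart.Equations`. -/
theorem isVariety : (coordinates g T).IsVariety := by
  refine ⟨?_, ?_, fun k => ?_, coordinates_injective, ?_⟩
  · change Finite (SurfaceGen g n × Fin r × Fin r)
    infer_instance
  · change Finite (Σ i, Fin (T.s i))
    infer_instance
  · change Finite (Fin (tailSum (T.d k.1) k.2.succ) ↪o Fin r)
    infer_instance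
  refine Ambient.isLocallyClosed_of_isClosedOn ?_
  rintro _ ⟨p, rfl⟩
  obtain ⟨I, hI⟩ := Chart.exists_mem_domain p
  refine ⟨I.domain, I.isOpen_domain, hI, I.isClosedOn_equations.congr fun q hq => ⟨?_, fun h => ?_⟩⟩
  · rintro ⟨p', rfl⟩
    exact Chart.equations_toAmbient hq
  · exact ⟨_, h.toAmbient_toPRP hq⟩

end PRP

/-! ## Local sections and geometric quotients -/

theorem Coordinates.comp_mem_fractions {X : Type} {c : Coordinates X} {W : Set (Ambient c.ι c.K c.J)}
    {f : Ambient c.ι c.K c.J → ℂ} (hf : f ∈ (Ambient.selfCoordinates c.ι c.K c.J).fractions W) :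
    f ∘ c.toAmbient ∈ c.fractions (c.toAmbient ⁻¹' W) := by
  obtain ⟨F, G, m, hF, hG, h⟩ := hf
  exact ⟨F, G, m, hF, hG, fun q hq => h _ hq⟩

/-- An invariant morphism whose fibres are orbits is a geometric quotient if it has local
sections. -/
theorem Coordinates.IsGeometricQuotient.of_local_sections {X Y H : Type} [Group H] [MulAction H X]
    {cX : Coordinates X} {cY : Coordinates Y} {f : X → Y} (hf : IsMorphism cX cY f)
    (hinv : ∀ (h : H) (x : X), f (h • x) = f x)
    (hfibre : ∀ x x' : X, f x = f x' → ∃ h : H, h • x = x')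
    (hsection : ∀ y, ∃ W : Set Y, IsOpen[cY.topology] W ∧ y ∈ W ∧ ∃ σ : Y → X,
      (∀ p ∈ W, f (σ p) = p) ∧ HasFractionLift cY cX W σ) :
    IsGeometricQuotient cX cY H f where
  isMorphism := hf
  invariant := hinv
  surjective y := by
    obtain ⟨W, -, hy, σ, hσ, -⟩ := hsection y
    exact ⟨σ y, hσ y hy⟩
  fibre_orbit := hfibre
  submersive U := by
    let _ := cX.topology
    let _ := cY.topology
    refine ⟨fun hU => hf.1.isOpen_preimage U hU, fun hU => isOpen_iff_forall_mem_open.mpr ?_⟩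
    intro y hyU
    obtain ⟨W, hW, hyW, σ, hσ, hlift⟩ := hsection y
    -- Since `f ∘ σ` is the identity on `W`, the neighbourhood `W ∩ σ⁻¹(f⁻¹ U)` of `y` lies in `U`.
    refine ⟨_, ?_, hlift.isOpen_inter_preimage hW hU, hyW, ?_⟩
    · rintro p ⟨hpW, hpU⟩
      simpa [hσ p hpW] using hpU
    · simpa [hσ y hyW] using hyU
  functions U hU k hk hkinv := by
    have hsurj : Function.Surjective f := fun y => by
      obtain ⟨W, -, hy, σ, hσ, -⟩ := hsection y
      exact ⟨σ y, hσ y hy⟩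
    have hfactor : ∀ x ∈ f ⁻¹' U, ∀ x', f x' = f x → k x' = k x := fun x hx x' hxx' => by
      obtain ⟨h, rfl⟩ := hfibre x x' hxx'.symm
      exact hkinv h x hx
    -- An arbitrary set-theoretic section defines the descended function, since `k` is constant on
    -- fibres over `U`. Regularity is checked below, where `k'` agrees with `k ∘ σ` for a local
    -- section `σ`.
    let k' : Y → ℂ := fun y => k (Function.surjInv hsurj y)
    have hk' : ∀ x ∈ f ⁻¹' U, k' (f x) = k x := fun x hx =>
      hfactor x hx _ (Function.surjInv_eq hsurj (f x))
    refine ⟨k', fun y hyU => ?_, hk'⟩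
    obtain ⟨W, hW, hyW, σ, hσ, hlift⟩ := hsection y
    have hmem : ∀ p ∈ W, (σ p ∈ f ⁻¹' U ↔ p ∈ U) := fun p hp => by
      rw [Set.mem_preimage, hσ p hp]
    obtain ⟨O, hO, hyO, hfrac⟩ := isRegularOn_iff.mp (hlift.isRegularOn_comp hW hk) y
      ⟨hyW, (hmem y hyW).mpr hyU⟩
    refine ⟨O ∩ W, @IsOpen.inter Y cY.topology _ _ hO hW, ⟨hyO, hyW⟩, mem_fractions.mp ?_⟩
    refine fractions_congr (fractions_anti ?_ hfrac) ?_
    · rintro p ⟨⟨hpO, hpW⟩, hpU⟩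
      exact ⟨hpO, hpW, (hmem p hpW).mpr hpU⟩
    · rintro p ⟨⟨hpO, hpW⟩, hpU⟩
      rw [Function.comp_apply, ← hk' _ ((hmem p hpW).mpr hpU), hσ p hpW]

/-! ### Sections over the charts, and the main theorem. -/

namespace PRP.Chart

variable {g n r : ℕ} {T : ParabolicType n r}

theorem exists_toPRP_eq {I : Chart T} {p : PRP g T}
    (hp : (coordinates g T).toAmbient p ∈ I.domain) :
    ∃ x : PRPRep g T, x.1 = I.quiverRep ((coordinates g T).toAmbient p) ∧ x.toPRP = p :=
  ⟨⟨_, (equations_toAmbient hp).isPRPRep hp⟩, rfl,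
    coordinates_injective ((equations_toAmbient hp).toAmbient_toPRP hp)⟩

/-- The normalized representation `quiverRep` lies over the given pair, and its entries are
fractions on the chart. -/
theorem exists_section (p : PRP g T) : ∃ W : Set (PRP g T),
    IsOpen[(coordinates g T).topology] W ∧ p ∈ W ∧ ∃ σ : PRP g T → PRPRep g T,
      (∀ p' ∈ W, (σ p').toPRP = p') ∧
        HasFractionLift (coordinates g T) (PRPRep.coordinates g T) W σ := by
  classical
  obtain ⟨I, hI⟩ := exists_mem_domain p
  -- The section is a total function with arbitrary values outside the chart, so some representation
  -- must be available.
  have : Nonempty (PRPRep g T) := ⟨(exists_toPRP_eq hI).choose⟩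
  choose! σ hσ using fun (p' : PRP g T) (hp' : (coordinates g T).toAmbient p' ∈ I.domain) =>
    exists_toPRP_eq hp'
  refine ⟨(coordinates g T).toAmbient ⁻¹' I.domain, ⟨_, I.isOpen_domain, rfl⟩, hI, σ,
    fun p' hp' => (hσ p' hp').2, ?_⟩
  refine ⟨Sum.elim (fun e p' => I.quiverRep ((coordinates g T).toAmbient p') e.1 e.2.1 e.2.2)
    fun kj => Empty.elim kj.1, ?_, fun p' hp' => ⟨?_, fun k => Empty.elim k⟩⟩
  · rintro (⟨a, i, j⟩ | ⟨k, -⟩)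
    · exact comp_mem_fractions (I.isFractionMatrix_quiverRep a i j)
    · exact Empty.elim k
  · rintro ⟨a, i, j⟩
    exact congrFun₂ (congrFun (hσ p' hp').1 a) i j

end PRP.Chart

theorem mainTheorem9 (g n r : ℕ) (T : ParabolicType n r) :
    (PRPRep.coordinates g T).IsVariety ∧ (PRP.coordinates g T).IsVariety ∧
    ∃ φ : PRPRep g T → PRP g T,
      (∀ (x : PRPRep g T) (a : SurfaceGen g n),
        (((φ x).ρ (SurfaceGroup.gen a) : GL (Fin r) ℂ) : Matrix (Fin r) (Fin r) ℂ) =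
          x.1.central a) ∧
      (∀ (x : PRPRep g T) (i : Fin n) (ℓ : Fin (T.s i + 1)),
        ((φ x).flag i).sub ℓ = LinearMap.range (Matrix.mulVecLin (x.1.legComposite i ℓ))) ∧
      Coordinates.IsMorphism (PRPRep.coordinates g T) (PRP.coordinates g T) φ ∧
      (∀ (h : QuiverGL T) (x : PRPRep g T), φ (h • x) = h.atCenter • φ x) ∧
      Coordinates.IsGeometricQuotient (PRPRep.coordinates g T) (PRP.coordinates g T)
        (QuiverGL.legSubgroup T) φ := by
  have hmor := (PRPRep.hasFractionLift_toPRP (g := g) (T := T)).isMorphism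
  refine ⟨PRPRep.isVariety, PRP.isVariety, PRPRep.toPRP, PRPRep.toPRP_rho, PRPRep.toPRP_sub,
    hmor, PRPRep.toPRP_smul, .of_local_sections hmor (fun h x => ?_)
      (fun x y => PRPRep.exists_smul_eq_of_toPRP_eq) PRP.Chart.exists_section⟩
  have hcenter : h.1.atCenter = 1 := h.2
  rw [Subgroup.smul_def, PRPRep.toPRP_smul, hcenter, one_smul]
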